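/- Let $F$ be an absolutely continuous probability distribution on $\Theta=[0,1]$ with mean $m^\varnothing$, and let $\mathcal G(F)$ be the set of mean-preserving contractions of $F$. For $0<k<m^\varnothing$ let $\underline u_k=m^\varnothing-k$, and let $\bar u_k$ be the unique solution $u$ of $k=\int_u^1(\theta-u)\,dF(\theta)$. For $n\ge 1$ consider the following game between brokers $1,\dots,n$ and an agent. In each period $t=1,2,\dots$ in which he is still searching, the agent pays the search cost $k$ and samples a good whose quality $\theta_t\sim F$ (i.i.d.) nobody observes. The brokers simultaneously make public offers $o_{it}=(p_{it},G_{it})\in[0,\infty)\times\mathcal G(F)$ of a price and a posterior-mean distribution. The agent accepts one of these offers or the null offer (price $0$, distribution degenerate at $m^\varnothing$) and pays its price. A posterior mean $m_t$ is then drawn from the chosen distribution and publicly observed, and the agent either consumes the good, which ends the game, or continues to period $t+1$ (without recall). Behavioral strategies may depend on the full public history of offers, purchase decisions and realizations. If the search ends in period $T$, Broker $i$'s payoff is the sum of the prices that the agent has paid her, and the agent's payoff is the quality $\theta_T$ of the consumed good (whose conditional expectation given the realization is $m_T$) minus all search costs and prices paid; the agent's payoff is $-\infty$ if the search never ends. All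 players maximize expected payoffs. An equilibrium is a sequentially rational strategy profile: after every history no player can gain by deviating at the beginning of a period, and the agent cannot gain by deviating at any of his purchase or stopping decisions either. Let $\mathcal E(n,k)\subseteq\mathbb R^{n+1}$ be the set of equilibrium payoff profiles (the brokers' payoffs $y_1,\dots,y_n$ and the agent's payoff $y_{n+1}$), and let $$\mathcal F(n,k)=\Big\{y\in\mathbb R_+^{n+1}:\ y_{n+1}\ge\underline u_k,\ \sum_{j=1}^{n+1}y_j\le\bar u_k\Big\}$$ be the feasible payoff set. There is a unique threshold $k^*\in(0,m^\varnothing)$ such that $\mathcal E(1,k)=\mathcal F(1,k)$ for all $0<k\le k^*$ and $\mathcal E(1,k)=\{(\bar u_k-\underline u_k,\underline u_k)\}$ for all $k^*<k<m^\varnothing$. With this threshold, for every $0<k\le k^*$ and every $n>1$, $$\mathcal E(n,k)=\mathcal F(n,k).$$ -/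

import Mathlib

open MeasureTheory ProbabilityTheory
open scoped ENNReal NNReal

noncomputable section

namespace PersuadedSearch

/-! ### Search environment -/

/-- The set `Θ = [0,1]` of qualities and of posterior means. -/
abbrev Θ : Type := unitInterval

/-- The prior mean `m^∅ = ∫ θ dF(θ)` of the quality distribution `F` on `Θ = [0,1]`. -/
def priorMean (F : ProbabilityMeasure Θ) : ℝ := ∫ θ : Θ, (θ : ℝ) ∂(F : Measure Θ)

theorem priorMean_mem (F : ProbabilityMeasure Θ) : priorMean F ∈ Set.Icc (0 : ℝ) 1 := by
  refine ⟨integral_nonneg fun θ => θ.2.1, ?_⟩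
  have h : priorMean F ≤ ∫ _ : Θ, (1 : ℝ) ∂(F : Measure Θ) :=
    integral_mono_of_nonneg (ae_of_all _ fun θ => θ.2.1) (integrable_const _)
      (ae_of_all _ fun θ => θ.2.2)
  simpa using h

/-- The prior mean as a point of `Θ`. -/
def priorPoint (F : ProbabilityMeasure Θ) : Θ := ⟨priorMean F, priorMean_mem F⟩

/-- The autarky payoff `m^∅ - k`. -/
def autarky (F : ProbabilityMeasure Θ) (k : ℝ) : ℝ := priorMean F - k

/-- The McCall payoff: the solution `u` of `k = ∫_u^1 (θ - u) dF(θ)`, which is unique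
for `0 < k < m^∅`, so that the infimum below is that of a one-point set. -/
def mcCall (F : ProbabilityMeasure Θ) (k : ℝ) : ℝ :=
  sInf {u : ℝ | k = ∫ θ : Θ, max ((θ : ℝ) - u) 0 ∂(F : Measure Θ)}

/-- `G` is a mean-preserving contraction of `F`: it is dominated by `F` in the convex order. -/
def IsMPC (F G : ProbabilityMeasure Θ) : Prop :=
  ∀ φ : ℝ → ℝ, ConvexOn ℝ (Set.Icc 0 1) φ → ContinuousOn φ (Set.Icc 0 1) →
    ∫ m : Θ, φ m ∂(G : Measure Θ) ≤ ∫ θ : Θ, φ θ ∂(F : Measure Θ)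

/-! ### Offers, purchases, histories -/

/-- Signals: the posterior-mean distributions that are mean-preserving contractions of `F`. -/
abbrev Signal (F : ProbabilityMeasure Θ) := {G : ProbabilityMeasure Θ // IsMPC F G}

/-- Take-it-or-leave-it offers: a price in `[0,∞)` and a signal. -/
abbrev Offer (F : ProbabilityMeasure Θ) := ℝ≥0 × Signal F

/-- A profile of offers, one for each of the `n` brokers. -/
abbrev Offers (F : ProbabilityMeasure Θ) (n : ℕ) := Fin n → Offer F

/-- Purchase decisions: `some i` buys from broker `i`, `none` takes the null offer. -/
abbrev Choice (n : ℕ) := Option (Fin n)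

instance (n : ℕ) : MeasurableSpace (Choice n) := ⊤

/-- The public record of one period: offers, purchase decision, signal realization. -/
abbrev Round (F : ProbabilityMeasure Θ) (n : ℕ) := Offers F n × Choice n × Θ

/-- Histories after `t` completed periods of search, `t = 0, 1, 2, …`. -/
abbrev Hist (F : ProbabilityMeasure Θ) (n t : ℕ) := Fin t → Round F n

/-- The price paid under a purchase decision. -/
def price {F : ProbabilityMeasure Θ} {n : ℕ} (O : Offers F n) : Choice n → ℝ≥0
  | none => 0
  | some i => (O i).1

/-- The distribution of the observed posterior mean under a purchase decision. The null
offer is uninformative. -/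
def signalLaw {F : ProbabilityMeasure Θ} {n : ℕ} (O : Offers F n) : Choice n → Measure Θ
  | none => Measure.dirac (priorPoint F)
  | some i => (((O i).2 : ProbabilityMeasure Θ) : Measure Θ)

/-! ### Strategies -/

/-- Behavioral strategies of a broker. -/
structure BrokerStrategy (F : ProbabilityMeasure Θ) (n : ℕ) where
  offer : ∀ t, Kernel (Hist F n t) (Offer F)
  markov : ∀ t, IsMarkovKernel (offer t)

/-- Behavioral strategies of the agent: the purchase decision, and the probability of
continuing the search after a signal realization. -/
structure AgentStrategy (F : ProbabilityMeasure Θ) (n : ℕ) where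
  buy : ∀ t, Kernel (Hist F n t × Offers F n) (Choice n)
  markov : ∀ t, IsMarkovKernel (buy t)
  cont : ∀ t, Hist F n t × Offers F n × Choice n × Θ → unitInterval
  measurable_cont : ∀ t, Measurable (cont t)

/-- Strategy profiles. -/
structure Profile (F : ProbabilityMeasure Θ) (n : ℕ) where
  broker : Fin n → BrokerStrategy F n
  agent : AgentStrategy F n

variable {F : ProbabilityMeasure Θ} {n : ℕ}

/-- Broker `i` deviates to `τ`. -/
def Profile.withBroker (σ : Profile F n) (i : Fin n) (τ : BrokerStrategy F n) : Profile F n :=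
  { σ with broker := Function.update σ.broker i τ }

/-- The agent deviates to `τ`. -/
def Profile.withAgent (σ : Profile F n) (τ : AgentStrategy F n) : Profile F n :=
  { σ with agent := τ }

/-- The law of the profile of offers made after the history `h` (brokers randomize
independently). -/
def Profile.offersLaw (σ : Profile F n) (t : ℕ) (h : Hist F n t) : Measure (Offers F n) :=
  Measure.pi fun i => (σ.broker i).offer t h

/-- Probability of the purchase decision `w` after `(h, O)`. -/
def Profile.buyProb (σ : Profile F n) (t : ℕ) (h : Hist F n t) (O : Offers F n)
    (w : Choice n) : ℝ≥0∞ :=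
  σ.agent.buy t (h, O) {w}

/-- Probability of continuing the search after `(h, O, w, m)`. -/
def Profile.contProb (σ : Profile F n) (t : ℕ) (h : Hist F n t) (O : Offers F n)
    (w : Choice n) (m : Θ) : ℝ≥0∞ :=
  ENNReal.ofReal (σ.agent.cont t (h, O, w, m) : ℝ)

/-- Probability of stopping the search after `(h, O, w, m)`. -/
def Profile.stopProb (σ : Profile F n) (t : ℕ) (h : Hist F n t) (O : Offers F n)
    (w : Choice n) (m : Θ) : ℝ≥0∞ :=
  ENNReal.ofReal (1 - (σ.agent.cont t (h, O, w, m) : ℝ))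

/-! ### Expectations along the play

For a family `g` of nonnegative functions of the histories, `σ.next g t h` is the expectation,
under the play of `σ` in the period that follows `h`, of `g` at the next history, on the event
that the agent continues. Its `s`-th iterate is therefore the expectation, conditional on `h`, of
`g` at the history reached `s` periods later, on the event that the agent is then still
searching. -/

/-- As `σ.next`, with the current offers `O` given. -/
def Profile.nextAt (σ : Profile F n) (g : ∀ t, Hist F n t → ℝ≥0∞) (t : ℕ) (h : Hist F n t)
    (O : Offers F n) : ℝ≥0∞ :=
  ∑ w : Choice n, σ.buyProb t h O w *
    ∫⁻ m, σ.contProb t h O w m * g (t + 1) (Fin.snoc h (O, w, m)) ∂(signalLaw O w)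

/-- Expectation of `g` at the next history, on the event that the agent continues. -/
def Profile.next (σ : Profile F n) (g : ∀ t, Hist F n t → ℝ≥0∞) (t : ℕ) (h : Hist F n t) :
    ℝ≥0∞ :=
  ∫⁻ O, σ.nextAt g t h O ∂(σ.offersLaw t h)

/-- If `g` is an expected amount accruing in the current period, this is the expected total
accruing from the history `h` until the search ends. -/
def Profile.total (σ : Profile F n) (g : ∀ t, Hist F n t → ℝ≥0∞) (t : ℕ) (h : Hist F n t) :
    ℝ≥0∞ :=
  ∑' s : ℕ, (σ.next^[s] g) t h

/-! ### Payoffs -/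

/-- Broker `i`'s expected revenue in the current period. -/
def Profile.revenue (σ : Profile F n) (i : Fin n) (t : ℕ) (h : Hist F n t) : ℝ≥0∞ :=
  ∫⁻ O, σ.buyProb t h O (some i) * ((O i).1 : ℝ≥0∞) ∂(σ.offersLaw t h)

/-- Broker `i`'s expected payoff from the history `h` on: the expected sum of the prices
she collects until the search ends. -/
def Profile.brokerPayoff (σ : Profile F n) (i : Fin n) (t : ℕ) (h : Hist F n t) : ℝ≥0∞ :=
  σ.total (σ.revenue i) t h

/-- Expected quality consumed in the current period, given the offers. Conditional on the
posterior mean `m`, the expected quality of the sampled good is `m`. -/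
def Profile.consumeAt (σ : Profile F n) (t : ℕ) (h : Hist F n t) (O : Offers F n) : ℝ≥0∞ :=
  ∑ w : Choice n, σ.buyProb t h O w *
    ∫⁻ m, σ.stopProb t h O w m * ENNReal.ofReal (m : ℝ) ∂(signalLaw O w)

/-- Expected outlay (search cost and price) in the current period, given the offers. -/
def Profile.outlayAt (σ : Profile F n) (k : ℝ) (t : ℕ) (h : Hist F n t) (O : Offers F n) :
    ℝ≥0∞ :=
  ENNReal.ofReal k + ∑ w : Choice n, σ.buyProb t h O w * (price O w : ℝ≥0∞)

/-- Expected quality of the good that is eventually consumed, from `h` on. -/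
def Profile.quality (σ : Profile F n) : ∀ t, Hist F n t → ℝ≥0∞ :=
  σ.total fun t h => ∫⁻ O, σ.consumeAt t h O ∂(σ.offersLaw t h)

/-- Expected total of search costs and prices paid by the agent, from `h` on. It is infinite
if the search fails to end with positive probability and `0 < k`. -/
def Profile.outlay (σ : Profile F n) (k : ℝ) : ∀ t, Hist F n t → ℝ≥0∞ :=
  σ.total fun t h => ∫⁻ O, σ.outlayAt k t h O ∂(σ.offersLaw t h)

/-- The agent's expected payoff from the history `h` on. The expected quality is at
most `1`, so the difference is never indeterminate; the value may be `-∞`. -/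
def Profile.agentPayoff (σ : Profile F n) (k : ℝ) (t : ℕ) (h : Hist F n t) : EReal :=
  (σ.quality t h : EReal) - (σ.outlay k t h : EReal)

/-- The agent's expected payoff once the current offers `O` have been made. -/
def Profile.agentPayoffAtOffers (σ : Profile F n) (k : ℝ) (t : ℕ) (h : Hist F n t)
    (O : Offers F n) : EReal :=
  ((σ.consumeAt t h O + σ.nextAt σ.quality t h O : ℝ≥0∞) : EReal) -
    ((σ.outlayAt k t h O + σ.nextAt (σ.outlay k) t h O : ℝ≥0∞) : EReal)

/-- The agent's expected payoff once the posterior mean `m` has been observed, net of the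
current search cost and price, which are sunk. -/
def Profile.agentPayoffAtSignal (σ : Profile F n) (k : ℝ) (t : ℕ) (h : Hist F n t)
    (O : Offers F n) (w : Choice n) (m : Θ) : EReal :=
  ((σ.stopProb t h O w m * ENNReal.ofReal (m : ℝ) +
      σ.contProb t h O w m * σ.quality (t + 1) (Fin.snoc h (O, w, m)) : ℝ≥0∞) : EReal) -
    ((σ.contProb t h O w m * σ.outlay k (t + 1) (Fin.snoc h (O, w, m)) : ℝ≥0∞) : EReal)

/-! ### Equilibrium and payoff sets -/

/-- Sequential rationality: after every history no broker can gain by deviating, and the agent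
can gain by deviating neither at the beginning of a period, nor at a purchase decision, nor
at a stopping decision. -/
structure IsEquilibrium (k : ℝ) (σ : Profile F n) : Prop where
  broker : ∀ (i : Fin n) (t : ℕ) (h : Hist F n t) (τ : BrokerStrategy F n),
    (σ.withBroker i τ).brokerPayoff i t h ≤ σ.brokerPayoff i t h
  agent : ∀ (t : ℕ) (h : Hist F n t) (τ : AgentStrategy F n),
    (σ.withAgent τ).agentPayoff k t h ≤ σ.agentPayoff k t h
  agent_purchase : ∀ (t : ℕ) (h : Hist F n t) (O : Offers F n) (τ : AgentStrategy F n),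
    (σ.withAgent τ).agentPayoffAtOffers k t h O ≤ σ.agentPayoffAtOffers k t h O
  agent_stopping : ∀ (t : ℕ) (h : Hist F n t) (O : Offers F n) (w : Choice n) (m : Θ)
    (τ : AgentStrategy F n),
    (σ.withAgent τ).agentPayoffAtSignal k t h O w m ≤ σ.agentPayoffAtSignal k t h O w m

/-- The equilibrium payoff set `𝓔(n,k)`; coordinates `0, …, n-1` belong to the brokers and the
last one to the agent. -/
def equilibriumPayoffs (F : ProbabilityMeasure Θ) (n : ℕ) (k : ℝ) : Set (Fin (n + 1) → ℝ) :=
  {y | ∃ σ : Profile F n, IsEquilibrium k σ ∧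
    (∀ i : Fin n, (σ.brokerPayoff i 0 Fin.elim0 : EReal) = (y i.castSucc : EReal)) ∧
    σ.agentPayoff k 0 Fin.elim0 = (y (Fin.last n) : EReal)}

/-- The feasible payoff set `𝓕(n,k)`. -/
def feasiblePayoffs (F : ProbabilityMeasure Θ) (n : ℕ) (k : ℝ) : Set (Fin (n + 1) → ℝ) :=
  {y | (∀ j, 0 ≤ y j) ∧ autarky F k ≤ y (Fin.last n) ∧ ∑ j, y j ≤ mcCall F k}

/-- `kstar` is the threshold of the monopolistic market: up to `kstar` every feasible payoff is an
equilibrium payoff, and above `kstar` the monopolist extracts the full surplus. -/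
structure IsMonopolyThreshold (F : ProbabilityMeasure Θ) (kstar : ℝ) : Prop where
  pos : 0 < kstar
  lt_priorMean : kstar < priorMean F
  folk : ∀ k, 0 < k → k ≤ kstar → equilibriumPayoffs F 1 k = feasiblePayoffs F 1 k
  extraction : ∀ k, kstar < k → k < priorMean F →
    equilibriumPayoffs F 1 k = {![mcCall F k - autarky F k, autarky F k]}

end PersuadedSearch

end

noncomputable section

namespace PersuadedSearch

variable {F : ProbabilityMeasure Θ} {n : ℕ}

/-! ### Measurability of the play -/

/-! Write `m` for the prior mean, `u̲ = m - k` for the autarky payoff and `u̅` for the McCall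
payoff. Two bounds hold for every number of brokers. Prices are transfers, and no signal makes one
draw with outside option `u̅` worth more than `E max(θ, u̅) = u̅ + k`; telescoping over periods,
total surplus is at most `u̅` (`Profile.surplus_le`). The agent secures `u̲` by taking the null
offer and consuming the first good (`IsEquilibrium.outlay_add_autarky_le`). Hence equilibrium
payoffs are feasible.

Conversely, suppose that `E max(θ, u̲) ≤ u̅`. Every feasible payoff is then supported by three
phases, in each of which all brokers make the same offer. The signal mixes the point mass at `m`
with full information. Since `F` has no atoms, the realization reveals which component was drawn,
and it selects continuation value `u̲` or `u̅`; the mixing weight thus tunes the surplus to any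
level between `u̲` and `u̅`. Prices are charged only in the first period, and the agent's
randomization splits them among the brokers. After a deviating offer the agent buys nothing and is
promised `u̅`. Accepting an offer instead would lead to `u̲` and be worth at most `E max(θ, u̲) ≤
u̅` even at price zero, so no deviation ever sells. The number of brokers is irrelevant to this
argument (`feasiblePayoffs_subset`).

The condition holds exactly up to a cutoff `κ`, because `excess F (E max(θ, u̲)) - k` is
nonincreasing in `k`, nonnegative for small `k` and negative at `k = m` (`exists_threshold`). Above
`κ` a monopolist extracts everything: let `c` be the infimum of her equilibrium continuation payoffs
and `M` the supremum of the agent's. If `M > m`, selling full information just below `E max(θ, u̲) -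
M > u̅ - M ≥ c` beats `c`. So `M ≤ m`, and repeated sale of the binary signal "is `θ ≥ u̅`?" forces
`c ≥ u̅ - u̲` (`IsEquilibrium.extraction`). An explicit equilibrium attains this payoff
(`extraction_mem`). The cutoff is therefore a monopoly threshold; it is the only one
(`exists_unique_threshold`), and the folk construction applies below it for every number of brokers.

Optimality of the agent's strategies is checked by a Bellman verification argument. All amounts are
nonnegative extended reals, and differences are avoided by keeping quality and outlay on opposite
sides. -/

instance (O : Offers F n) (w : Choice n) : IsProbabilityMeasure (signalLaw O w) := by
  cases w <;> simp only [signalLaw] <;> infer_instance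

instance (σ : Profile F n) (t : ℕ) (h : Hist F n t) :
    IsProbabilityMeasure (σ.offersLaw t h) := by
  have : ∀ i, IsProbabilityMeasure ((σ.broker i).offer t h) := fun i =>
    have := (σ.broker i).markov t
    inferInstance
  unfold Profile.offersLaw
  infer_instance

theorem Profile.measurable_offersLaw (σ : Profile F n) (t : ℕ) : Measurable (σ.offersLaw t) := by
  have hM : ∀ i h, IsProbabilityMeasure ((σ.broker i).offer t h) := fun i h =>
    have := (σ.broker i).markov t
    inferInstance
  -- Measurable rectangles form a generating π-system, on which the product law is a finite product
  -- of kernel values.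
  refine Measurable.measure_of_isPiSystem_of_isProbabilityMeasure generateFrom_pi.symm isPiSystem_pi ?_
  rintro _ ⟨s, hs, rfl⟩
  have : (fun h => σ.offersLaw t h (Set.univ.pi s)) =
      fun h => ∏ i, (σ.broker i).offer t h (s i) := by
    funext h
    exact Measure.pi_pi _ _
  rw [this]
  exact Finset.measurable_prod _ fun i _ =>
    Kernel.measurable_coe _ (hs i (Set.mem_univ i))

theorem measurable_signalLaw (w : Choice n) :
    Measurable (fun O : Offers F n => signalLaw O w) := by
  cases w with
  | none => exact measurable_const
  | some i =>
    exact measurable_subtype_coe.comp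
      (measurable_subtype_coe.comp (measurable_snd.comp (measurable_pi_apply i)))

theorem measurable_price (w : Choice n) :
    Measurable (fun O : Offers F n => (price O w : ℝ≥0∞)) := by
  cases w with
  | none => simp only [price]; exact measurable_const
  | some i => exact (measurable_fst.comp (measurable_pi_apply i)).coe_nnreal_ennreal

theorem measurable_snoc (t : ℕ) :
    Measurable (fun p : Hist F n t × Round F n => (Fin.snoc p.1 p.2 : Hist F n (t + 1))) := by
  refine measurable_pi_iff.2 fun j => ?_
  refine Fin.lastCases ?_ (fun j => ?_) j
  · simpa using measurable_snd
  · simpa only [Fin.snoc_castSucc] using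
      (show Measurable fun p : Hist F n t × Round F n => p.1 j from
        (measurable_pi_apply j).comp measurable_fst)

theorem Profile.measurable_buyProb (σ : Profile F n) (t : ℕ) (w : Choice n) :
    Measurable (fun p : Hist F n t × Offers F n => σ.buyProb t p.1 p.2 w) :=
  Kernel.measurable_coe _ (measurableSet_singleton w)

theorem Profile.sum_buyProb (σ : Profile F n) (t : ℕ) (h : Hist F n t) (O : Offers F n) :
    ∑ w, σ.buyProb t h O w = 1 := by
  have := σ.agent.markov t
  have h1 := measure_univ (μ := σ.agent.buy t (h, O))
  rw [← h1, ← Finset.coe_univ, ← sum_measure_singleton]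
  rfl

theorem Profile.buyProb_le_one (σ : Profile F n) (t : ℕ) (h : Hist F n t) (O : Offers F n)
    (w : Choice n) : σ.buyProb t h O w ≤ 1 := by
  have := σ.agent.markov t
  exact prob_le_one

theorem Profile.measurable_contProb (σ : Profile F n) (t : ℕ) (w : Choice n) :
    Measurable (fun p : (Hist F n t × Offers F n) × Θ =>
      σ.contProb t p.1.1 p.1.2 w p.2) := by
  unfold Profile.contProb
  have := σ.agent.measurable_cont t
  fun_prop

theorem Profile.measurable_stopProb (σ : Profile F n) (t : ℕ) (w : Choice n) :
    Measurable (fun p : (Hist F n t × Offers F n) × Θ =>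
      σ.stopProb t p.1.1 p.1.2 w p.2) := by
  unfold Profile.stopProb
  have := σ.agent.measurable_cont t
  fun_prop

theorem Profile.stopProb_add_contProb (σ : Profile F n) (t : ℕ) (h : Hist F n t)
    (O : Offers F n) (w : Choice n) (m : Θ) :
    σ.stopProb t h O w m + σ.contProb t h O w m = 1 := by
  unfold Profile.contProb Profile.stopProb
  have := (σ.agent.cont t (h, O, w, m)).2
  rw [← ENNReal.ofReal_add (by linarith [this.2]) this.1]
  simp

theorem Profile.contProb_le_one (σ : Profile F n) (t : ℕ) (h : Hist F n t)
    (O : Offers F n) (w : Choice n) (m : Θ) : σ.contProb t h O w m ≤ 1 :=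
  (σ.stopProb_add_contProb t h O w m) ▸ le_add_self

theorem measurable_lintegral_signalLaw {α : Type*} [MeasurableSpace α] (w : Choice n)
    {f : (α × Offers F n) × Θ → ℝ≥0∞} (hf : Measurable f) :
    Measurable (fun p : α × Offers F n => ∫⁻ m, f (p, m) ∂(signalLaw p.2 w)) := by
  let κ : Kernel (α × Offers F n) Θ := ⟨fun p => signalLaw p.2 w,
    (measurable_signalLaw w).comp measurable_snd⟩
  have : IsMarkovKernel κ := ⟨fun p => by dsimp [κ]; infer_instance⟩
  exact hf.lintegral_kernel_prod_right' (κ := κ)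

theorem Profile.measurable_lintegral_offersLaw (σ : Profile F n) (t : ℕ)
    {f : Hist F n t × Offers F n → ℝ≥0∞} (hf : Measurable f) :
    Measurable (fun h => ∫⁻ O, f (h, O) ∂(σ.offersLaw t h)) := by
  let κ : Kernel (Hist F n t) (Offers F n) := ⟨σ.offersLaw t, σ.measurable_offersLaw t⟩
  have : IsMarkovKernel κ := ⟨fun p => by dsimp [κ]; infer_instance⟩
  exact hf.lintegral_kernel_prod_right' (κ := κ)

theorem measurable_at_snoc {g : ∀ t, Hist F n t → ℝ≥0∞} (hg : ∀ t, Measurable (g t)) (t : ℕ)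
    (w : Choice n) :
    Measurable (fun p : (Hist F n t × Offers F n) × Θ =>
      g (t + 1) (Fin.snoc p.1.1 (p.1.2, w, p.2))) :=
  (hg (t + 1)).comp ((measurable_snoc t).comp (by fun_prop :
    Measurable (fun p : (Hist F n t × Offers F n) × Θ => (p.1.1, ((p.1.2, w, p.2) : Round F n)))))

theorem measurable_at_snoc_right {g : ∀ t, Hist F n t → ℝ≥0∞} (hg : ∀ t, Measurable (g t)) (t : ℕ)
    (h : Hist F n t) (O : Offers F n) (w : Choice n) :
    Measurable (fun m : Θ => g (t + 1) (Fin.snoc h (O, w, m))) :=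
  (measurable_at_snoc hg t w).comp (measurable_prodMk_left (x := (h, O)))

theorem Profile.measurable_contProb_right (σ : Profile F n) (t : ℕ) (h : Hist F n t)
    (O : Offers F n) (w : Choice n) : Measurable (fun m => σ.contProb t h O w m) :=
  (σ.measurable_contProb t w).comp (measurable_prodMk_left (x := (h, O)))

theorem Profile.measurable_stopProb_right (σ : Profile F n) (t : ℕ) (h : Hist F n t)
    (O : Offers F n) (w : Choice n) : Measurable (fun m => σ.stopProb t h O w m) :=
  (σ.measurable_stopProb t w).comp (measurable_prodMk_left (x := (h, O)))

theorem measurable_quality_coe : Measurable (fun m : Θ => ENNReal.ofReal (m : ℝ)) :=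
  ENNReal.measurable_ofReal.comp measurable_subtype_coe

theorem Profile.measurable_nextAt (σ : Profile F n) {g : ∀ t, Hist F n t → ℝ≥0∞}
    (hg : ∀ t, Measurable (g t)) (t : ℕ) :
    Measurable (fun p : Hist F n t × Offers F n => σ.nextAt g t p.1 p.2) := by
  unfold Profile.nextAt
  refine Finset.measurable_sum _ fun w _ => (σ.measurable_buyProb t w).mul ?_
  exact measurable_lintegral_signalLaw w ((σ.measurable_contProb t w).mul (measurable_at_snoc hg t w))

theorem Profile.measurable_consumeAt (σ : Profile F n) (t : ℕ) :
    Measurable (fun p : Hist F n t × Offers F n => σ.consumeAt t p.1 p.2) := by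
  unfold Profile.consumeAt
  refine Finset.measurable_sum _ fun w _ => (σ.measurable_buyProb t w).mul ?_
  exact measurable_lintegral_signalLaw w
    ((σ.measurable_stopProb t w).mul (measurable_quality_coe.comp measurable_snd))

theorem Profile.measurable_outlayAt (σ : Profile F n) (k : ℝ) (t : ℕ) :
    Measurable (fun p : Hist F n t × Offers F n => σ.outlayAt k t p.1 p.2) := by
  unfold Profile.outlayAt
  refine measurable_const.add (Finset.measurable_sum _ fun w _ =>
    (σ.measurable_buyProb t w).mul ((measurable_price w).comp measurable_snd))

theorem Profile.measurable_next (σ : Profile F n) {g : ∀ t, Hist F n t → ℝ≥0∞}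
    (hg : ∀ t, Measurable (g t)) (t : ℕ) : Measurable (σ.next g t) :=
  σ.measurable_lintegral_offersLaw t (σ.measurable_nextAt hg t)

theorem Profile.measurable_iterate_next (σ : Profile F n) {g : ∀ t, Hist F n t → ℝ≥0∞}
    (hg : ∀ t, Measurable (g t)) (s t : ℕ) : Measurable (σ.next^[s] g t) := by
  induction s generalizing t with
  | zero => exact hg t
  | succ s ih =>
    rw [Function.iterate_succ_apply']
    exact σ.measurable_next ih t

theorem Profile.measurable_total (σ : Profile F n) {g : ∀ t, Hist F n t → ℝ≥0∞}
    (hg : ∀ t, Measurable (g t)) (t : ℕ) : Measurable (σ.total g t) :=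
  Measurable.tsum fun s => σ.measurable_iterate_next hg s t

theorem Profile.measurable_revenue (σ : Profile F n) (i : Fin n) (t : ℕ) :
    Measurable (σ.revenue i t) :=
  σ.measurable_lintegral_offersLaw t
    ((σ.measurable_buyProb t (some i)).mul ((measurable_price (some i)).comp measurable_snd))

theorem Profile.measurable_consume (σ : Profile F n) (t : ℕ) :
    Measurable (fun h => ∫⁻ O, σ.consumeAt t h O ∂(σ.offersLaw t h)) :=
  σ.measurable_lintegral_offersLaw t (σ.measurable_consumeAt t)

theorem Profile.measurable_periodOutlay (σ : Profile F n) (k : ℝ) (t : ℕ) :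
    Measurable (fun h => ∫⁻ O, σ.outlayAt k t h O ∂(σ.offersLaw t h)) :=
  σ.measurable_lintegral_offersLaw t (σ.measurable_outlayAt k t)

theorem Profile.measurable_outlay (σ : Profile F n) (k : ℝ) (t : ℕ) : Measurable (σ.outlay k t) :=
  σ.measurable_total (σ.measurable_periodOutlay k) t

theorem Profile.measurable_nextAt_right (σ : Profile F n) {g : ∀ t, Hist F n t → ℝ≥0∞}
    (hg : ∀ t, Measurable (g t)) (t : ℕ) (h : Hist F n t) :
    Measurable (fun O => σ.nextAt g t h O) :=
  (σ.measurable_nextAt hg t).comp measurable_prodMk_left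

theorem Profile.measurable_consumeAt_right (σ : Profile F n) (t : ℕ) (h : Hist F n t) :
    Measurable (fun O => σ.consumeAt t h O) :=
  (σ.measurable_consumeAt t).comp measurable_prodMk_left

theorem Profile.measurable_outlayAt_right (σ : Profile F n) (k : ℝ) (t : ℕ) (h : Hist F n t) :
    Measurable (fun O => σ.outlayAt k t h O) :=
  by
  have := (σ.measurable_outlayAt k t).comp (measurable_prodMk_left (x := h))
  exact this

/-! ### Linearity of the one-period expectation -/

theorem Profile.nextAt_mono (σ : Profile F n) {g g' : ∀ t, Hist F n t → ℝ≥0∞} {t : ℕ}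
    (hg : ∀ h, g (t + 1) h ≤ g' (t + 1) h) (h : Hist F n t) (O : Offers F n) :
    σ.nextAt g t h O ≤ σ.nextAt g' t h O := by
  unfold Profile.nextAt
  gcongr
  exact hg _

theorem Profile.next_mono (σ : Profile F n) {g g' : ∀ t, Hist F n t → ℝ≥0∞} {t : ℕ}
    (hg : ∀ h, g (t + 1) h ≤ g' (t + 1) h) (h : Hist F n t) : σ.next g t h ≤ σ.next g' t h :=
  lintegral_mono fun O => σ.nextAt_mono hg h O

theorem Profile.nextAt_add (σ : Profile F n) {g g' : ∀ t, Hist F n t → ℝ≥0∞}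
    (hg : ∀ t, Measurable (g t)) (t : ℕ) (h : Hist F n t) (O : Offers F n) :
    σ.nextAt (fun t h => g t h + g' t h) t h O = σ.nextAt g t h O + σ.nextAt g' t h O := by
  unfold Profile.nextAt
  rw [← Finset.sum_add_distrib]
  refine Finset.sum_congr rfl fun w _ => ?_
  rw [← mul_add, ← lintegral_add_left]
  · simp_rw [mul_add]
  · exact (σ.measurable_contProb_right t h O w).mul (measurable_at_snoc_right hg t h O w)

theorem Profile.next_add (σ : Profile F n) {g g' : ∀ t, Hist F n t → ℝ≥0∞}
    (hg : ∀ t, Measurable (g t)) (t : ℕ) (h : Hist F n t) :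
    σ.next (fun t h => g t h + g' t h) t h = σ.next g t h + σ.next g' t h := by
  unfold Profile.next
  rw [← lintegral_add_left (σ.measurable_nextAt_right hg t h)]
  simp_rw [σ.nextAt_add hg]

theorem Profile.nextAt_const_mul (σ : Profile F n) {g : ∀ t, Hist F n t → ℝ≥0∞}
    (hg : ∀ t, Measurable (g t)) (c : ℝ≥0∞) (t : ℕ) (h : Hist F n t) (O : Offers F n) :
    σ.nextAt (fun t h => c * g t h) t h O = c * σ.nextAt g t h O := by
  unfold Profile.nextAt
  rw [Finset.mul_sum]
  refine Finset.sum_congr rfl fun w _ => ?_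
  rw [mul_left_comm, ← lintegral_const_mul c]
  · simp only [mul_left_comm c]
  · exact (σ.measurable_contProb_right t h O w).mul (measurable_at_snoc_right hg t h O w)

theorem Profile.next_const_mul (σ : Profile F n) {g : ∀ t, Hist F n t → ℝ≥0∞}
    (hg : ∀ t, Measurable (g t)) (c : ℝ≥0∞) (t : ℕ) (h : Hist F n t) :
    σ.next (fun t h => c * g t h) t h = c * σ.next g t h := by
  unfold Profile.next
  rw [← lintegral_const_mul _ (σ.measurable_nextAt_right hg t h)]
  simp_rw [σ.nextAt_const_mul hg]

theorem Profile.nextAt_tsum (σ : Profile F n) {g : ℕ → ∀ t, Hist F n t → ℝ≥0∞}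
    (hg : ∀ s t, Measurable (g s t)) (t : ℕ) (h : Hist F n t) (O : Offers F n) :
    σ.nextAt (fun t h => ∑' s, g s t h) t h O = ∑' s, σ.nextAt (g s) t h O := by
  unfold Profile.nextAt
  rw [Summable.tsum_finsetSum (fun _ _ => ENNReal.summable)]
  refine Finset.sum_congr rfl fun w _ => ?_
  rw [ENNReal.tsum_mul_left, ← lintegral_tsum]
  · simp_rw [ENNReal.tsum_mul_left]
  · exact fun s => ((σ.measurable_contProb_right t h O w).mul
      (measurable_at_snoc_right (hg s) t h O w)).aemeasurable

theorem Profile.next_tsum (σ : Profile F n) {g : ℕ → ∀ t, Hist F n t → ℝ≥0∞}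
    (hg : ∀ s t, Measurable (g s t)) (t : ℕ) (h : Hist F n t) :
    σ.next (fun t h => ∑' s, g s t h) t h = ∑' s, σ.next (g s) t h := by
  unfold Profile.next
  rw [← lintegral_tsum fun s => (σ.measurable_nextAt_right (hg s) t h).aemeasurable]
  simp_rw [σ.nextAt_tsum hg]

/-! ### Totals, partial totals and telescoping inequalities -/

theorem Profile.total_eq (σ : Profile F n) {g : ∀ t, Hist F n t → ℝ≥0∞}
    (hg : ∀ t, Measurable (g t)) (t : ℕ) (h : Hist F n t) :
    σ.total g t h = g t h + σ.next (σ.total g) t h := by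
  have h1 : σ.next (σ.total g) t h = ∑' s, σ.next (σ.next^[s] g) t h :=
    σ.next_tsum (fun s t => σ.measurable_iterate_next hg s t) t h
  have h2 : σ.total g t h = (σ.next^[0] g) t h + ∑' s, (σ.next^[s + 1] g) t h :=
    tsum_eq_zero_add' (f := fun s => (σ.next^[s] g) t h) ENNReal.summable
  rw [h1, h2]
  simp only [Function.iterate_succ_apply', Function.iterate_zero, id]

/-- Partial sums of the total. -/
def Profile.partialTotal (σ : Profile F n) (g : ∀ t, Hist F n t → ℝ≥0∞) (N t : ℕ)
    (h : Hist F n t) : ℝ≥0∞ :=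
  ∑ s ∈ Finset.range N, (σ.next^[s] g) t h

theorem Profile.measurable_partialTotal (σ : Profile F n) {g : ∀ t, Hist F n t → ℝ≥0∞}
    (hg : ∀ t, Measurable (g t)) (N t : ℕ) : Measurable (σ.partialTotal g N t) :=
  Finset.measurable_fun_sum _ fun s _ => σ.measurable_iterate_next hg s t

theorem Profile.partialTotal_succ (σ : Profile F n) {g : ∀ t, Hist F n t → ℝ≥0∞}
    (hg : ∀ t, Measurable (g t)) (N t : ℕ) (h : Hist F n t) :
    σ.partialTotal g (N + 1) t h = g t h + σ.next (σ.partialTotal g N) t h := by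
  induction N with
  | zero =>
    have : σ.next (σ.partialTotal g 0) t h = 0 := by
      simp [Profile.next, Profile.nextAt, Profile.partialTotal]
    simp [this, Profile.partialTotal]
  | succ N ih =>
    have h1 : ∀ t h, σ.partialTotal g (N + 1) t h =
        σ.partialTotal g N t h + (σ.next^[N] g) t h := fun t h => by
      simp [Profile.partialTotal, Finset.sum_range_succ]
    have h2 : σ.partialTotal g (N + 1 + 1) t h =
        σ.partialTotal g (N + 1) t h + σ.next (σ.next^[N] g) t h := by
      rw [← Function.iterate_succ_apply' σ.next]
      simp [Profile.partialTotal, Finset.sum_range_succ]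
    rw [h2, ih, add_assoc, ← σ.next_add (σ.measurable_partialTotal hg N)]
    congr 2
    funext t h
    exact (h1 t h).symm

theorem Profile.tendsto_partialTotal (σ : Profile F n) (g : ∀ t, Hist F n t → ℝ≥0∞) (t : ℕ)
    (h : Hist F n t) :
    Filter.Tendsto (fun N => σ.partialTotal g N t h) Filter.atTop (nhds (σ.total g t h)) :=
  ENNReal.tendsto_nat_tsum _

theorem Profile.partialTotal_le (σ : Profile F n) (g : ∀ t, Hist F n t → ℝ≥0∞) (N t : ℕ)
    (h : Hist F n t) : σ.partialTotal g N t h ≤ σ.total g t h :=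
  ENNReal.sum_le_tsum _

/-- Induction on the horizon: the one-period inequality is applied now, and the induction hypothesis
inside `σ.next`. The additive form avoids subtraction, so infinite values need no separate
treatment. -/
theorem Profile.partialTotal_add_le (σ : Profile F n) {a c W : ∀ t, Hist F n t → ℝ≥0∞}
    (ha : ∀ t, Measurable (a t)) (hc : ∀ t, Measurable (c t))
    (hstep : ∀ t h, a t h + σ.next W t h ≤ c t h + W t h) (N t : ℕ) (h : Hist F n t) :
    σ.partialTotal a N t h + σ.next^[N] W t h ≤ σ.partialTotal c N t h + W t h := by
  induction N generalizing t with
  | zero => simp [Profile.partialTotal]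
  | succ N ih =>
    rw [σ.partialTotal_succ ha, σ.partialTotal_succ hc, Function.iterate_succ_apply', add_assoc,
      ← σ.next_add (σ.measurable_partialTotal ha N)]
    calc a t h + σ.next (fun t h => σ.partialTotal a N t h + σ.next^[N] W t h) t h
        ≤ a t h + σ.next (fun t h => σ.partialTotal c N t h + W t h) t h := by
          gcongr
          exact σ.next_mono (fun h => ih (t + 1) h) h
      _ = σ.next (σ.partialTotal c N) t h + (a t h + σ.next W t h) := by
          rw [σ.next_add (σ.measurable_partialTotal hc N)]; ring
      _ ≤ σ.next (σ.partialTotal c N) t h + (c t h + W t h) := by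
          exact add_le_add_right (hstep t h) _
      _ = _ := by ring

theorem Profile.le_partialTotal_add (σ : Profile F n) {a c W : ∀ t, Hist F n t → ℝ≥0∞}
    (ha : ∀ t, Measurable (a t)) (hc : ∀ t, Measurable (c t))
    (hstep : ∀ t h, c t h + W t h ≤ a t h + σ.next W t h) (N t : ℕ) (h : Hist F n t) :
    σ.partialTotal c N t h + W t h ≤ σ.partialTotal a N t h + σ.next^[N] W t h := by
  induction N generalizing t with
  | zero => simp [Profile.partialTotal]
  | succ N ih =>
    rw [σ.partialTotal_succ ha, σ.partialTotal_succ hc, Function.iterate_succ_apply',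
      add_assoc (a t h), ← σ.next_add (σ.measurable_partialTotal ha N)]
    calc c t h + σ.next (σ.partialTotal c N) t h + W t h
        = σ.next (σ.partialTotal c N) t h + (c t h + W t h) := by ring
      _ ≤ σ.next (σ.partialTotal c N) t h + (a t h + σ.next W t h) := by
          exact add_le_add_right (hstep t h) _
      _ = a t h + σ.next (fun t h => σ.partialTotal c N t h + W t h) t h := by
          rw [σ.next_add (σ.measurable_partialTotal hc N)]; ring
      _ ≤ _ := by
          gcongr
          exact σ.next_mono (fun h => ih (t + 1) h) h

/-- Since `W` is nonnegative, the term left over at the horizon can be dropped, and no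
transversality condition is needed. Every upper bound on payoffs below is an instance of this. -/
theorem Profile.total_le_total_add (σ : Profile F n) {a c W : ∀ t, Hist F n t → ℝ≥0∞}
    (ha : ∀ t, Measurable (a t)) (hc : ∀ t, Measurable (c t))
    (hstep : ∀ t h, a t h + σ.next W t h ≤ c t h + W t h)
    (t : ℕ) (h : Hist F n t) : σ.total a t h ≤ σ.total c t h + W t h := by
  refine le_of_tendsto (σ.tendsto_partialTotal a t h) (Filter.Eventually.of_forall fun N => ?_)
  calc σ.partialTotal a N t h ≤ σ.partialTotal a N t h + σ.next^[N] W t h := le_self_add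
    _ ≤ σ.partialTotal c N t h + W t h := σ.partialTotal_add_le ha hc hstep N t h
    _ ≤ _ := by gcongr; exact σ.partialTotal_le c N t h

theorem Profile.iterate_next_mono (σ : Profile F n) {g g' : ∀ t, Hist F n t → ℝ≥0∞} (hg : ∀ t h, g t h ≤ g' t h)
    (N t : ℕ) (h : Hist F n t) : σ.next^[N] g t h ≤ σ.next^[N] g' t h := by
  induction N generalizing t with
  | zero => exact hg t h
  | succ N ih =>
    simp only [Function.iterate_succ_apply']
    exact σ.next_mono (fun h => ih (t + 1) h) h

/-! ### Extended-real bookkeeping -/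

/-- Turns a comparison of payoffs into a subtraction-free inequality. Only the better payoff must
have finite outlay; a deviation may have infinite outlay and payoff `-∞`. -/
theorem ereal_sub_le_sub {q o q' o' : ℝ≥0∞} (h : q + o' ≤ q' + o) (ho' : o' ≠ ⊤) :
    (q : EReal) - (o : EReal) ≤ (q' : EReal) - (o' : EReal) := by
  rcases eq_or_ne o ⊤ with rfl | ho
  · simp
  rcases eq_or_ne q' ⊤ with rfl | hq'
  · lift o' to ℝ≥0 using ho'
    have : ((⊤ : ℝ≥0∞) : EReal) - ((o' : ℝ≥0∞) : EReal) = ⊤ := by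
      rw [EReal.coe_ennreal_top]
      exact EReal.top_sub_coe (o' : ℝ)
    rw [this]
    exact le_top
  have hq : q ≠ ⊤ := by
    rintro rfl
    simp [ho, hq'] at h
  lift o to ℝ≥0 using ho
  lift o' to ℝ≥0 using ho'
  lift q to ℝ≥0 using hq
  lift q' to ℝ≥0 using hq'
  have h2 : (q : ℝ) + o' ≤ q' + o := by exact_mod_cast h
  have h3 : (q : ℝ) - o ≤ q' - o' := by linarith
  simp only [EReal.coe_nnreal_eq_coe_real]
  exact_mod_cast h3

theorem ereal_sub_eq {q o w : ℝ≥0∞} (h : q = o + w) (ho : o ≠ ⊤) :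
    (q : EReal) - (o : EReal) = w := by
  subst h
  lift o to ℝ≥0 using ho
  rw [EReal.coe_ennreal_add, add_comm]
  exact EReal.add_sub_cancel_right (b := (o : ℝ))

/-- The converse of `ereal_sub_le_sub`. -/
theorem add_le_add_of_ereal_sub_le_sub {q o q' o' : ℝ≥0∞}
    (h : (q : EReal) - (o : EReal) ≤ (q' : EReal) - (o' : EReal)) (ho : o ≠ ⊤) (ho' : o' ≠ ⊤) :
    q + o' ≤ q' + o := by
  rcases eq_or_ne q' ⊤ with rfl | hq'
  · simp
  lift o to ℝ≥0 using ho
  lift o' to ℝ≥0 using ho'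
  lift q' to ℝ≥0 using hq'
  rcases eq_or_ne q ⊤ with rfl | hq
  · exfalso
    have h1 : ((⊤ : ℝ≥0∞) : EReal) - ((o : ℝ≥0∞) : EReal) = ⊤ := by
      rw [EReal.coe_ennreal_top]
      exact EReal.top_sub_coe (o : ℝ)
    rw [h1, top_le_iff] at h
    have : (((q' : ℝ) - (o' : ℝ) : ℝ) : EReal) = ⊤ := by exact_mod_cast h
    exact EReal.coe_ne_top _ this
  lift q to ℝ≥0 using hq
  simp only [EReal.coe_nnreal_eq_coe_real] at h
  have h3 : (q : ℝ) - o ≤ q' - o' := by exact_mod_cast h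
  have h2 : (q : ℝ) + o' ≤ q' + o := by linarith
  exact_mod_cast h2

/-! ### Bellman equations -/

theorem Profile.consumeAt_add_nextAt (σ : Profile F n) (W : ∀ t, Hist F n t → ℝ≥0∞)
    (t : ℕ) (h : Hist F n t) (O : Offers F n) :
    σ.consumeAt t h O + σ.nextAt W t h O = ∑ w, σ.buyProb t h O w *
      ∫⁻ m, (σ.stopProb t h O w m * ENNReal.ofReal (m : ℝ) +
        σ.contProb t h O w m * W (t + 1) (Fin.snoc h (O, w, m))) ∂(signalLaw O w) := by
  unfold Profile.consumeAt Profile.nextAt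
  rw [← Finset.sum_add_distrib]
  refine Finset.sum_congr rfl fun w _ => ?_
  rw [← mul_add, ← lintegral_add_left]
  exact (σ.measurable_stopProb_right t h O w).mul measurable_quality_coe

theorem Profile.stop_add_cont_le_max (σ : Profile F n) (t : ℕ) (h : Hist F n t) (O : Offers F n)
    (w : Choice n) (m : Θ) (a b : ℝ≥0∞) :
    σ.stopProb t h O w m * a + σ.contProb t h O w m * b ≤ max a b := by
  calc σ.stopProb t h O w m * a + σ.contProb t h O w m * b
      ≤ σ.stopProb t h O w m * max a b + σ.contProb t h O w m * max a b := by
        gcongr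
        · exact le_max_left _ _
        · exact le_max_right _ _
    _ = max a b := by rw [← add_mul, σ.stopProb_add_contProb, one_mul]

theorem ofReal_quality_le_one (m : Θ) : ENNReal.ofReal (m : ℝ) ≤ 1 :=
  ENNReal.ofReal_le_one.2 m.2.2

theorem Profile.consumeAt_add_nextAt_le_one (σ : Profile F n) {W : ∀ t, Hist F n t → ℝ≥0∞}
    (hW : ∀ t h, W t h ≤ 1) (t : ℕ) (h : Hist F n t) (O : Offers F n) :
    σ.consumeAt t h O + σ.nextAt W t h O ≤ 1 := by
  rw [σ.consumeAt_add_nextAt]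
  calc _ ≤ ∑ w, σ.buyProb t h O w * ∫⁻ _, 1 ∂(signalLaw O w) := by
        gcongr with w _ m
        exact (σ.stop_add_cont_le_max t h O w m _ _).trans
          (max_le (ofReal_quality_le_one m) (hW _ _))
    _ = 1 := by simp [σ.sum_buyProb]

theorem Profile.consume_add_next_le_one (σ : Profile F n) {W : ∀ t, Hist F n t → ℝ≥0∞}
    (hW : ∀ t h, W t h ≤ 1) (t : ℕ) (h : Hist F n t) :
    ∫⁻ O, σ.consumeAt t h O ∂(σ.offersLaw t h) + σ.next W t h ≤ 1 := by
  unfold Profile.next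
  rw [← lintegral_add_left (σ.measurable_consumeAt_right t h)]
  calc _ ≤ ∫⁻ _, 1 ∂(σ.offersLaw t h) :=
        lintegral_mono fun O => σ.consumeAt_add_nextAt_le_one hW t h O
    _ = 1 := by simp

theorem Profile.total_zero (σ : Profile F n) (t : ℕ) (h : Hist F n t) :
    σ.total (fun _ _ => 0) t h = 0 := by
  have : ∀ s t h, σ.next^[s] (fun _ _ => 0) t h = 0 := by
    intro s
    induction s with
    | zero => intro t h; rfl
    | succ s ih =>
      intro t h
      rw [Function.iterate_succ_apply']
      simp [Profile.next, Profile.nextAt, ih]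
  simp [Profile.total, this]

/-- The constant `1` dominates current consumption plus its own continuation, because one unit of
probability is split between stopping and continuing. -/
theorem Profile.quality_le_one (σ : Profile F n) (t : ℕ) (h : Hist F n t) :
    σ.quality t h ≤ 1 := by
  have := σ.total_le_total_add (a := fun t h => ∫⁻ O, σ.consumeAt t h O ∂(σ.offersLaw t h))
    (c := fun _ _ => 0) (W := fun _ _ => 1) σ.measurable_consume (fun _ => measurable_const)
    (fun t h => by simpa using σ.consume_add_next_le_one (fun _ _ => le_rfl) t h) t h
  refine this.trans ?_
  rw [σ.total_zero, zero_add]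

/-- Bellman inequality for the agent at the offers `O`. -/
theorem Profile.consumeAt_add_nextAt_le (σ : Profile F n) {k : ℝ}
    {W : ∀ t, Hist F n t → ℝ≥0∞} {t : ℕ} {h : Hist F n t} {O : Offers F n} {Y : ℝ≥0∞}
    (hX : ∀ w, ∫⁻ m, max (ENNReal.ofReal (m : ℝ)) (W (t + 1) (Fin.snoc h (O, w, m)))
      ∂(signalLaw O w) ≤ Y + price O w) :
    σ.consumeAt t h O + σ.nextAt W t h O + ENNReal.ofReal k ≤ σ.outlayAt k t h O + Y := by
  have : σ.consumeAt t h O + σ.nextAt W t h O ≤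
      ∑ w, σ.buyProb t h O w * (price O w : ℝ≥0∞) + Y := by
    rw [σ.consumeAt_add_nextAt]
    calc _ ≤ ∑ w, σ.buyProb t h O w * (Y + price O w) := by
          gcongr with w
          refine le_trans (lintegral_mono fun m => ?_) (hX w)
          exact σ.stop_add_cont_le_max t h O w m _ _
      _ = _ := by
          simp_rw [mul_add]
          rw [Finset.sum_add_distrib, ← Finset.sum_mul, σ.sum_buyProb, one_mul, add_comm]
  calc _ ≤ ∑ w, σ.buyProb t h O w * (price O w : ℝ≥0∞) + Y + ENNReal.ofReal k := by gcongr
    _ = _ := by unfold Profile.outlayAt; ring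

/-- If the agent's purchase and stopping decisions are optimal at the continuation values `W`,
then the Bellman inequality holds with equality. -/
theorem Profile.consumeAt_add_nextAt_eq (σ : Profile F n) {k : ℝ}
    {W : ∀ t, Hist F n t → ℝ≥0∞} {t : ℕ} {h : Hist F n t} {O : Offers F n} {Y : ℝ≥0∞}
    (hX : ∀ w, σ.buyProb t h O w ≠ 0 →
      ∫⁻ m, max (ENNReal.ofReal (m : ℝ)) (W (t + 1) (Fin.snoc h (O, w, m)))
      ∂(signalLaw O w) = Y + price O w)
    (hS : ∀ w m, σ.stopProb t h O w m * ENNReal.ofReal (m : ℝ) +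
      σ.contProb t h O w m * W (t + 1) (Fin.snoc h (O, w, m)) =
      max (ENNReal.ofReal (m : ℝ)) (W (t + 1) (Fin.snoc h (O, w, m)))) :
    σ.consumeAt t h O + σ.nextAt W t h O + ENNReal.ofReal k = σ.outlayAt k t h O + Y := by
  have : σ.consumeAt t h O + σ.nextAt W t h O =
      ∑ w, σ.buyProb t h O w * (price O w : ℝ≥0∞) + Y := by
    rw [σ.consumeAt_add_nextAt]
    calc _ = ∑ w, σ.buyProb t h O w * (Y + price O w) := by
          refine Finset.sum_congr rfl fun w _ => ?_
          simp_rw [hS]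
          by_cases hw : σ.buyProb t h O w = 0
          · simp [hw]
          · rw [hX w hw]
      _ = _ := by
          simp_rw [mul_add]
          rw [Finset.sum_add_distrib, ← Finset.sum_mul, σ.sum_buyProb, one_mul, add_comm]
  rw [this]
  unfold Profile.outlayAt
  ring

/-- The agent's dynamic program: `W` is the value at the beginning of a period and `Y` the value
once the offers are made, gross of the search cost; `optimal` says that no decision beats these
values. -/
structure Profile.BellmanBound (σ : Profile F n) (k : ℝ) (W : ∀ t, Hist F n t → ℝ≥0∞)
    (Y : ∀ t, Hist F n t → Offers F n → ℝ≥0∞) : Prop where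
  measurable : ∀ t, Measurable (W t)
  optimal : ∀ t h O w,
    ∫⁻ m, max (ENNReal.ofReal (m : ℝ)) (W (t + 1) (Fin.snoc h (O, w, m))) ∂(signalLaw O w) ≤
      Y t h O + price O w
  offers : ∀ t h, ∫⁻ O, Y t h O ∂(σ.offersLaw t h) = ENNReal.ofReal k + W t h

/-- The agent's decisions under `σ` attain the values `W`, `Y`. -/
structure Profile.BellmanAttained (σ : Profile F n) (k : ℝ) (W : ∀ t, Hist F n t → ℝ≥0∞)
    (Y : ∀ t, Hist F n t → Offers F n → ℝ≥0∞) : Prop extends σ.BellmanBound k W Y where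
  le_one : ∀ t h, W t h ≤ 1
  buy : ∀ t h O w, σ.buyProb t h O w ≠ 0 →
    ∫⁻ m, max (ENNReal.ofReal (m : ℝ)) (W (t + 1) (Fin.snoc h (O, w, m))) ∂(signalLaw O w) =
      Y t h O + price O w
  stopping : ∀ t h O w m, σ.stopProb t h O w m * ENNReal.ofReal (m : ℝ) +
      σ.contProb t h O w m * W (t + 1) (Fin.snoc h (O, w, m)) =
      max (ENNReal.ofReal (m : ℝ)) (W (t + 1) (Fin.snoc h (O, w, m)))

/-! ### Verification: Bellman values are payoffs and bound all deviations of the agent -/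

namespace Profile

variable {σ : Profile F n} {k : ℝ} {W : ∀ t, Hist F n t → ℝ≥0∞}
  {Y : ∀ t, Hist F n t → Offers F n → ℝ≥0∞}

theorem BellmanBound.consume_add_next_le (H : σ.BellmanBound k W Y) (t : ℕ) (h : Hist F n t) :
    ∫⁻ O, σ.consumeAt t h O ∂(σ.offersLaw t h) + σ.next W t h ≤
      ∫⁻ O, σ.outlayAt k t h O ∂(σ.offersLaw t h) + W t h := by
  refine (ENNReal.add_le_add_iff_right (a := ENNReal.ofReal k) ENNReal.ofReal_ne_top).1 ?_
  have h1 : ∫⁻ O, (σ.consumeAt t h O + σ.nextAt W t h O + ENNReal.ofReal k) ∂(σ.offersLaw t h) ≤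
      ∫⁻ O, (σ.outlayAt k t h O + Y t h O) ∂(σ.offersLaw t h) :=
    lintegral_mono fun O => σ.consumeAt_add_nextAt_le (H.optimal t h O)
  rw [lintegral_add_left (σ.measurable_outlayAt_right k t h), H.offers,
    lintegral_add_right _ measurable_const,
    lintegral_add_left (σ.measurable_consumeAt_right t h)] at h1
  simp only [lintegral_const, measure_univ, mul_one] at h1
  calc _ ≤ _ := h1
    _ = _ := by ring

theorem BellmanBound.quality_le (H : σ.BellmanBound k W Y) (t : ℕ) (h : Hist F n t) :
    σ.quality t h ≤ σ.outlay k t h + W t h :=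
  σ.total_le_total_add σ.measurable_consume (σ.measurable_periodOutlay k)
    H.consume_add_next_le t h

theorem BellmanBound.quality_at_offers_le (H : σ.BellmanBound k W Y) (t : ℕ) (h : Hist F n t)
    (O : Offers F n) :
    σ.consumeAt t h O + σ.nextAt σ.quality t h O + ENNReal.ofReal k ≤
      σ.outlayAt k t h O + σ.nextAt (σ.outlay k) t h O + Y t h O := by
  calc _ ≤ σ.consumeAt t h O + σ.nextAt (fun t h => σ.outlay k t h + W t h) t h O +
        ENNReal.ofReal k := by
        gcongr
        exact σ.nextAt_mono (fun h => H.quality_le _ h) h O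
    _ = σ.nextAt (σ.outlay k) t h O +
        (σ.consumeAt t h O + σ.nextAt W t h O + ENNReal.ofReal k) := by
        rw [σ.nextAt_add (σ.measurable_outlay k)]; ring
    _ ≤ σ.nextAt (σ.outlay k) t h O + (σ.outlayAt k t h O + Y t h O) :=
        add_le_add_right (σ.consumeAt_add_nextAt_le (H.optimal t h O)) _
    _ = _ := by ring

theorem BellmanBound.quality_at_signal_le (H : σ.BellmanBound k W Y) (t : ℕ) (h : Hist F n t)
    (O : Offers F n) (w : Choice n) (m : Θ) :
    σ.stopProb t h O w m * ENNReal.ofReal (m : ℝ) +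
        σ.contProb t h O w m * σ.quality (t + 1) (Fin.snoc h (O, w, m)) ≤
      σ.contProb t h O w m * σ.outlay k (t + 1) (Fin.snoc h (O, w, m)) +
        max (ENNReal.ofReal (m : ℝ)) (W (t + 1) (Fin.snoc h (O, w, m))) := by
  calc _ ≤ σ.stopProb t h O w m * ENNReal.ofReal (m : ℝ) +
        σ.contProb t h O w m * (σ.outlay k (t + 1) (Fin.snoc h (O, w, m)) +
          W (t + 1) (Fin.snoc h (O, w, m))) := by
        gcongr
        exact H.quality_le _ _
    _ = σ.contProb t h O w m * σ.outlay k (t + 1) (Fin.snoc h (O, w, m)) +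
        (σ.stopProb t h O w m * ENNReal.ofReal (m : ℝ) +
        σ.contProb t h O w m * W (t + 1) (Fin.snoc h (O, w, m))) := by ring
    _ ≤ _ := add_le_add_right (σ.stop_add_cont_le_max t h O w m _ _) _

theorem BellmanAttained.consume_add_next_eq (H : σ.BellmanAttained k W Y) (t : ℕ)
    (h : Hist F n t) :
    ∫⁻ O, σ.consumeAt t h O ∂(σ.offersLaw t h) + σ.next W t h =
      ∫⁻ O, σ.outlayAt k t h O ∂(σ.offersLaw t h) + W t h := by
  refine (ENNReal.add_left_inj (a := ENNReal.ofReal k) ENNReal.ofReal_ne_top).1 ?_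
  have h1 : ∫⁻ O, (σ.consumeAt t h O + σ.nextAt W t h O + ENNReal.ofReal k) ∂(σ.offersLaw t h) =
      ∫⁻ O, (σ.outlayAt k t h O + Y t h O) ∂(σ.offersLaw t h) :=
    lintegral_congr fun O => σ.consumeAt_add_nextAt_eq (H.buy t h O) (H.stopping t h O)
  rw [lintegral_add_left (σ.measurable_outlayAt_right k t h), H.offers,
    lintegral_add_right _ measurable_const,
    lintegral_add_left (σ.measurable_consumeAt_right t h)] at h1
  simp only [lintegral_const, measure_univ, mul_one] at h1
  calc _ = _ := h1
    _ = _ := by ring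

theorem BellmanAttained.partialTotal_outlay_add_le (H : σ.BellmanAttained k W Y) (N t : ℕ)
    (h : Hist F n t) :
    σ.partialTotal (fun t h => ∫⁻ O, σ.outlayAt k t h O ∂(σ.offersLaw t h)) N t h + W t h ≤
      σ.quality t h + σ.next^[N] W t h := by
  refine le_trans (σ.le_partialTotal_add σ.measurable_consume (σ.measurable_periodOutlay k)
    (fun t h => (H.consume_add_next_eq t h).ge) N t h) ?_
  gcongr
  exact σ.partialTotal_le _ N t h

/-- Up to any horizon, the outlay is at most the quality consumed so far plus the expected value
still ahead. As values are at most `1`, this is bounded by the quality consumed plus the probability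
of still searching, hence by `1`. -/
theorem BellmanAttained.outlay_le_one (H : σ.BellmanAttained k W Y) (t : ℕ) (h : Hist F n t) :
    σ.outlay k t h ≤ 1 := by
  refine le_of_tendsto (σ.tendsto_partialTotal _ t h) (Filter.Eventually.of_forall fun N => ?_)
  calc _ ≤ σ.partialTotal (fun t h => ∫⁻ O, σ.outlayAt k t h O ∂(σ.offersLaw t h)) N t h +
        W t h := le_self_add
    _ ≤ _ := σ.le_partialTotal_add σ.measurable_consume (σ.measurable_periodOutlay k)
        (fun t h => (H.consume_add_next_eq t h).ge) N t h
    _ ≤ σ.partialTotal (fun _ _ => 0) N t h + 1 :=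
        (add_le_add_right (σ.iterate_next_mono (fun t h => H.le_one t h) N t h) _).trans
          (σ.partialTotal_add_le (W := fun _ _ => 1) σ.measurable_consume
            (fun _ => measurable_const)
            (fun t h => by simpa using σ.consume_add_next_le_one (fun _ _ => le_rfl) t h) N t h)
    _ ≤ σ.total (fun _ _ => 0) t h + 1 := by gcongr; exact σ.partialTotal_le _ N t h
    _ = 1 := by rw [σ.total_zero, zero_add]

/-- The transversality condition. Every period of search costs at least `k`, so a function bounded
by `1` is at most the period outlay divided by `k`. The expected outlays are summable, so their
terms vanish. -/
theorem BellmanAttained.tendsto_iterate_next (H : σ.BellmanAttained k W Y) (hk : 0 < k)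
    {g : ∀ t, Hist F n t → ℝ≥0∞} (hg : ∀ t h, g t h ≤ 1) (t : ℕ) (h : Hist F n t) :
    Filter.Tendsto (fun N => σ.next^[N] g t h) Filter.atTop (nhds 0) := by
  have h1 : Filter.Tendsto (fun N => (ENNReal.ofReal k)⁻¹ *
      σ.next^[N] (fun t h => ∫⁻ O, σ.outlayAt k t h O ∂(σ.offersLaw t h)) t h)
      Filter.atTop (nhds ((ENNReal.ofReal k)⁻¹ * 0)) :=
    ENNReal.Tendsto.const_mul (ENNReal.tendsto_atTop_zero_of_tsum_ne_top
      (ne_top_of_le_ne_top ENNReal.one_ne_top (H.outlay_le_one t h)))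
      (Or.inr (ENNReal.inv_ne_top.2 (by simpa using hk)))
  rw [mul_zero] at h1
  refine tendsto_of_tendsto_of_tendsto_of_le_of_le tendsto_const_nhds h1
    (fun _ => zero_le) fun N => ?_
  have h2 : ∀ t h, g t h ≤ (ENNReal.ofReal k)⁻¹ *
      ∫⁻ O, σ.outlayAt k t h O ∂(σ.offersLaw t h) := fun t h => by
    calc g t h ≤ 1 := hg t h
      _ = (ENNReal.ofReal k)⁻¹ * ENNReal.ofReal k :=
          (ENNReal.inv_mul_cancel (by simpa using hk) ENNReal.ofReal_ne_top).symm
      _ = (ENNReal.ofReal k)⁻¹ * ∫⁻ _, ENNReal.ofReal k ∂(σ.offersLaw t h) := by simp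
      _ ≤ _ := by
        gcongr with O
        exact le_self_add
  have h3 : ∀ N t h, σ.next^[N] (fun t h => (ENNReal.ofReal k)⁻¹ *
      ∫⁻ O, σ.outlayAt k t h O ∂(σ.offersLaw t h)) t h = (ENNReal.ofReal k)⁻¹ *
      σ.next^[N] (fun t h => ∫⁻ O, σ.outlayAt k t h O ∂(σ.offersLaw t h)) t h := by
    intro N
    induction N with
    | zero => intro t h; rfl
    | succ N ih =>
      intro t h
      simp only [Function.iterate_succ_apply']
      rw [← σ.next_const_mul (σ.measurable_iterate_next (σ.measurable_periodOutlay k) N)]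
      congr 1
      funext t h
      exact ih t h
  exact (σ.iterate_next_mono h2 N t h).trans (h3 N t h).le

theorem BellmanAttained.quality_eq (H : σ.BellmanAttained k W Y) (hk : 0 < k) (t : ℕ)
    (h : Hist F n t) : σ.quality t h = σ.outlay k t h + W t h := by
  refine le_antisymm (H.toBellmanBound.quality_le t h) ?_
  have h1 := ((σ.tendsto_partialTotal
    (fun t h => ∫⁻ O, σ.outlayAt k t h O ∂(σ.offersLaw t h)) t h).add_const (W t h))
  have h2 := (H.tendsto_iterate_next hk H.le_one t h).const_add (σ.quality t h)
  rw [add_zero] at h2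
  exact le_of_tendsto_of_tendsto' h1 h2 fun N => H.partialTotal_outlay_add_le N t h

theorem BellmanAttained.outlay_ne_top (H : σ.BellmanAttained k W Y) (t : ℕ) (h : Hist F n t) :
    σ.outlay k t h ≠ ⊤ :=
  ne_top_of_le_ne_top ENNReal.one_ne_top (H.outlay_le_one t h)

theorem BellmanAttained.agentPayoff_eq (H : σ.BellmanAttained k W Y) (hk : 0 < k) (t : ℕ)
    (h : Hist F n t) : σ.agentPayoff k t h = W t h :=
  ereal_sub_eq (H.quality_eq hk t h) (H.outlay_ne_top t h)

/-- The bound refers only to the brokers' offers and to the set of available decisions, not to the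
agent's strategy. This is why one set of values controls every deviation of the agent, however long.
-/
theorem BellmanBound.withAgent (H : σ.BellmanBound k W Y) (τ : AgentStrategy F n) :
    (σ.withAgent τ).BellmanBound k W Y :=
  ⟨H.measurable, H.optimal, H.offers⟩

theorem BellmanAttained.agent (H : σ.BellmanAttained k W Y) (hk : 0 < k) (t : ℕ)
    (h : Hist F n t) (τ : AgentStrategy F n) :
    (σ.withAgent τ).agentPayoff k t h ≤ σ.agentPayoff k t h := by
  refine ereal_sub_le_sub ?_ (H.outlay_ne_top t h)
  rw [H.quality_eq hk t h]
  calc _ ≤ (σ.withAgent τ).outlay k t h + W t h + σ.outlay k t h := by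
        gcongr; exact (H.toBellmanBound.withAgent τ).quality_le t h
    _ = _ := by ring

theorem nextAt_le_one (σ : Profile F n) {g : ∀ t, Hist F n t → ℝ≥0∞} (hg : ∀ t h, g t h ≤ 1)
    (t : ℕ) (h : Hist F n t) (O : Offers F n) : σ.nextAt g t h O ≤ 1 :=
  le_trans le_add_self (σ.consumeAt_add_nextAt_le_one hg t h O)

theorem outlayAt_ne_top (σ : Profile F n) (k : ℝ) (t : ℕ) (h : Hist F n t) (O : Offers F n) :
    σ.outlayAt k t h O ≠ ⊤ := by
  unfold outlayAt
  refine ENNReal.add_ne_top.2 ⟨ENNReal.ofReal_ne_top, ?_⟩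
  refine ENNReal.sum_ne_top.2 fun w _ => ENNReal.mul_ne_top ?_ ENNReal.coe_ne_top
  exact ne_top_of_le_ne_top ENNReal.one_ne_top (σ.buyProb_le_one t h O w)

theorem BellmanAttained.quality_at_offers_eq (H : σ.BellmanAttained k W Y) (hk : 0 < k) (t : ℕ)
    (h : Hist F n t) (O : Offers F n) :
    σ.consumeAt t h O + σ.nextAt σ.quality t h O + ENNReal.ofReal k =
      σ.outlayAt k t h O + σ.nextAt (σ.outlay k) t h O + Y t h O := by
  have h1 : σ.quality = fun t h => σ.outlay k t h + W t h := by
    funext t h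
    exact H.quality_eq hk t h
  rw [h1, σ.nextAt_add (σ.measurable_outlay k)]
  calc _ = σ.nextAt (σ.outlay k) t h O +
        (σ.consumeAt t h O + σ.nextAt W t h O + ENNReal.ofReal k) := by ring
    _ = _ := by
      rw [σ.consumeAt_add_nextAt_eq (H.buy t h O) (H.stopping t h O)]
      ring

theorem BellmanAttained.agent_purchase (H : σ.BellmanAttained k W Y) (hk : 0 < k) (t : ℕ)
    (h : Hist F n t) (O : Offers F n) (τ : AgentStrategy F n) :
    (σ.withAgent τ).agentPayoffAtOffers k t h O ≤ σ.agentPayoffAtOffers k t h O := by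
  refine ereal_sub_le_sub ?_ (ENNReal.add_ne_top.2 ⟨σ.outlayAt_ne_top k t h O,
    ne_top_of_le_ne_top ENNReal.one_ne_top (σ.nextAt_le_one H.outlay_le_one t h O)⟩)
  have h1 := (H.toBellmanBound.withAgent τ).quality_at_offers_le t h O
  have h2 := H.quality_at_offers_eq hk t h O
  refine (ENNReal.add_le_add_iff_right (a := ENNReal.ofReal k) ENNReal.ofReal_ne_top).1 ?_
  calc _ = ((σ.withAgent τ).consumeAt t h O +
        (σ.withAgent τ).nextAt (σ.withAgent τ).quality t h O + ENNReal.ofReal k) +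
        (σ.outlayAt k t h O + σ.nextAt (σ.outlay k) t h O) := by ring
    _ ≤ _ := add_le_add_left h1 _
    _ = ((σ.withAgent τ).outlayAt k t h O +
        (σ.withAgent τ).nextAt ((σ.withAgent τ).outlay k) t h O) +
        (σ.outlayAt k t h O + σ.nextAt (σ.outlay k) t h O + Y t h O) := by ring
    _ = _ := by rw [← h2]; ring

theorem BellmanAttained.agent_stopping (H : σ.BellmanAttained k W Y) (hk : 0 < k) (t : ℕ)
    (h : Hist F n t) (O : Offers F n) (w : Choice n) (m : Θ) (τ : AgentStrategy F n) :
    (σ.withAgent τ).agentPayoffAtSignal k t h O w m ≤ σ.agentPayoffAtSignal k t h O w m := by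
  refine ereal_sub_le_sub ?_ (ENNReal.mul_ne_top
    (ne_top_of_le_ne_top ENNReal.one_ne_top (σ.contProb_le_one t h O w m))
    (H.outlay_ne_top _ _))
  have h1 := (H.toBellmanBound.withAgent τ).quality_at_signal_le t h O w m
  rw [H.quality_eq hk]
  calc _ ≤ _ := add_le_add_left h1 _
    _ = _ := by rw [← H.stopping t h O w m]; ring

/-- A bound on what broker `i` can earn against the other players' strategies. -/
theorem brokerPayoff_withBroker_le {i : Fin n} {B : ∀ t, Hist F n t → ℝ≥0∞}
    (hB : ∀ t, Measurable (B t))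
    (H : ∀ t h O, σ.buyProb t h O (some i) * ((O i).1 : ℝ≥0∞) + σ.nextAt B t h O ≤ B t h)
    (τ : BrokerStrategy F n) (t : ℕ) (h : Hist F n t) :
    (σ.withBroker i τ).brokerPayoff i t h ≤ B t h := by
  have key := (σ.withBroker i τ).total_le_total_add (c := fun _ _ => 0) (W := B)
    ((σ.withBroker i τ).measurable_revenue i) (fun _ => measurable_const) (fun t h => ?_) t h
  · rwa [total_zero, zero_add] at key
  · rw [zero_add]
    unfold revenue next
    rw [← lintegral_add_right _ (Profile.measurable_nextAt_right _ hB t h)]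
    calc _ ≤ ∫⁻ _, B t h ∂((σ.withBroker i τ).offersLaw t h) := lintegral_mono fun O => H t h O
      _ = _ := by simp

end Profile

/-! ### The McCall problem -/

theorem integrable_of_continuous (G : ProbabilityMeasure Θ) {f : Θ → ℝ} (hf : Continuous f) :
    Integrable f (G : Measure Θ) :=
  hf.integrable_of_hasCompactSupport (HasCompactSupport.of_compactSpace f)

/-- The expected gain `∫ (θ - u)⁺ dF(θ)` from one more draw. -/
def excess (F : ProbabilityMeasure Θ) (u : ℝ) : ℝ := ∫ θ : Θ, max ((θ : ℝ) - u) 0 ∂(F : Measure Θ)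

/-- The expected value of a draw from `G` with outside option `v`. -/
def expMax (G : ProbabilityMeasure Θ) (v : ℝ) : ℝ := ∫ m : Θ, max (m : ℝ) v ∂(G : Measure Θ)

theorem expMax_eq (G : ProbabilityMeasure Θ) (v : ℝ) : expMax G v = v + excess G v := by
  unfold expMax excess
  have h : ∀ m : Θ, max (m : ℝ) v = v + max ((m : ℝ) - v) 0 := fun m => by
    rw [← max_add_add_left]; simp
  simp_rw [h]
  rw [integral_add (integrable_const _) (integrable_of_continuous G (by fun_prop))]
  simp

theorem excess_nonneg (F : ProbabilityMeasure Θ) (u : ℝ) : 0 ≤ excess F u :=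
  integral_nonneg fun _ => le_max_right _ _

theorem excess_anti {u v : ℝ} (h : u ≤ v) : excess F v ≤ excess F u :=
  integral_mono (integrable_of_continuous F (by fun_prop)) (integrable_of_continuous F (by fun_prop))
    fun θ => max_le_max (sub_le_sub_left h _) le_rfl

theorem expMax_mono {u v : ℝ} (h : u ≤ v) : expMax F u ≤ expMax F v :=
  integral_mono (integrable_of_continuous F (by fun_prop)) (integrable_of_continuous F (by fun_prop))
    fun θ => max_le_max le_rfl h

theorem excess_le_add {u v : ℝ} (h : u ≤ v) : excess F u ≤ excess F v + (v - u) := by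
  have := expMax_mono (F := F) h
  rw [expMax_eq, expMax_eq] at this
  linarith

theorem continuous_excess (F : ProbabilityMeasure Θ) : Continuous (excess F) := by
  refine LipschitzWith.continuous (K := 1) (LipschitzWith.of_le_add_mul 1 fun u v => ?_)
  rw [NNReal.coe_one, one_mul, Real.dist_eq]
  rcases le_total u v with h | h
  · rw [abs_of_nonpos (by linarith)]
    linarith [excess_le_add (F := F) h]
  · linarith [excess_anti (F := F) h, abs_nonneg (u - v)]

theorem continuous_expMax (F : ProbabilityMeasure Θ) : Continuous (expMax F) := by
  simp_rw [funext (expMax_eq F)]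
  exact continuous_id.add (continuous_excess F)

theorem excess_of_nonpos {u : ℝ} (hu : u ≤ 0) : excess F u = priorMean F - u := by
  unfold excess priorMean
  have : ∀ θ : Θ, max ((θ : ℝ) - u) 0 = θ - u := fun θ => max_eq_left (by linarith [θ.2.1])
  simp_rw [this]
  rw [integral_sub (integrable_of_continuous F (by fun_prop)) (integrable_const _)]
  simp

theorem excess_of_one_le {u : ℝ} (hu : 1 ≤ u) : excess F u = 0 := by
  unfold excess
  have : ∀ θ : Θ, max ((θ : ℝ) - u) 0 = 0 := fun θ => max_eq_right (by linarith [θ.2.2])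
  simp [this]

theorem le_excess (F : ProbabilityMeasure Θ) (u : ℝ) : priorMean F - u ≤ excess F u := by
  have h : priorMean F - u = ∫ θ : Θ, ((θ : ℝ) - u) ∂(F : Measure Θ) := by
    rw [integral_sub (integrable_of_continuous F (by fun_prop)) (integrable_const _)]
    simp [priorMean]
  rw [h]
  exact integral_mono (integrable_of_continuous F (by fun_prop))
    (integrable_of_continuous F (by fun_prop)) fun θ => le_max_left _ _

/-- Pointwise, `(1 - u)(θ - v)⁺ ≤ (1 - v)(θ - u)⁺` because `θ ≤ 1`. This gives strict monotonicity
of `excess` wherever it is positive, without any assumption on the support of `F`. -/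
theorem mul_excess_le {u v : ℝ} (huv : u ≤ v) (hv : v ≤ 1) :
    (1 - u) * excess F v ≤ (1 - v) * excess F u := by
  unfold excess
  rw [← integral_const_mul, ← integral_const_mul]
  refine integral_mono (integrable_of_continuous F (by fun_prop))
    (integrable_of_continuous F (by fun_prop)) fun θ => ?_
  have h1 := θ.2.2
  dsimp only
  rcases le_total ((θ : ℝ) - v) 0 with h | h
  · rw [max_eq_right h, mul_zero]
    exact mul_nonneg (by linarith) (le_max_right _ _)
  · rw [max_eq_left h, max_eq_left (by linarith)]
    nlinarith

theorem excess_lt {u v : ℝ} (huv : u < v) (hu : 0 < excess F u) : excess F v < excess F u := by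
  have hu1 : u < 1 := by
    by_contra h
    rw [excess_of_one_le (not_lt.1 h)] at hu
    exact lt_irrefl _ hu
  rcases le_total v 1 with hv | hv
  · have := mul_excess_le (F := F) huv.le hv
    by_contra h
    nlinarith
  · rwa [excess_of_one_le hv]

theorem excess_mcCall {k : ℝ} (hk : 0 < k) (hk' : k < priorMean F) :
    excess F (mcCall F k) = k ∧ 0 < mcCall F k ∧ mcCall F k < 1 := by
  have h0 : excess F 0 = priorMean F := by rw [excess_of_nonpos le_rfl, sub_zero]
  have h1 : excess F 1 = 0 := excess_of_one_le le_rfl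
  obtain ⟨u, hu, hku⟩ := intermediate_value_Ioo' (zero_le_one' ℝ) (continuous_excess F).continuousOn
    (show k ∈ Set.Ioo (excess F 1) (excess F 0) by rw [h0, h1]; exact ⟨hk, hk'⟩)
  have : {u : ℝ | k = ∫ θ : Θ, max ((θ : ℝ) - u) 0 ∂(F : Measure Θ)} = {u} := by
    ext v
    change k = excess F v ↔ v = u
    constructor
    · intro hv
      rcases lt_trichotomy v u with h | h | h
      · have := excess_lt h (by rw [← hv]; exact hk)
        linarith
      · exact h
      · have := excess_lt h (by rw [hku]; exact hk)
        linarith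
    · rintro rfl
      exact hku.symm
  have hm : mcCall F k = u := by
    unfold mcCall
    rw [this, csInf_singleton]
  rw [hm]
  exact ⟨hku, hu.1, hu.2⟩

theorem le_mcCall {k v : ℝ} (hk : 0 < k) (hk' : k < priorMean F) (h : k ≤ excess F v) :
    v ≤ mcCall F k := by
  obtain ⟨h1, -, -⟩ := excess_mcCall hk hk'
  by_contra hlt
  have := excess_lt (F := F) (not_le.1 hlt) (by rw [h1]; exact hk)
  linarith

theorem mcCall_lt {k v : ℝ} (hk : 0 < k) (hk' : k < priorMean F) (h : excess F v < k) :
    mcCall F k < v := by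
  obtain ⟨h1, -, -⟩ := excess_mcCall hk hk'
  by_contra hlt
  have := excess_anti (F := F) (not_lt.1 hlt)
  linarith

theorem autarky_le_mcCall {k : ℝ} (hk : 0 < k) (hk' : k < priorMean F) :
    autarky F k ≤ mcCall F k := by
  refine le_mcCall hk hk' ?_
  have := le_excess F (autarky F k)
  unfold autarky at *
  linarith

theorem expMax_mcCall {k : ℝ} (hk : 0 < k) (hk' : k < priorMean F) :
    expMax F (mcCall F k) = mcCall F k + k := by
  rw [expMax_eq, (excess_mcCall hk hk').1]

/-! ### Mean-preserving contractions -/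

theorem integrable_convex (G : ProbabilityMeasure Θ) {φ : ℝ → ℝ}
    (hφ : ContinuousOn φ (Set.Icc 0 1)) : Integrable (fun m : Θ => φ m) (G : Measure Θ) :=
  integrable_of_continuous G (continuousOn_iff_continuous_domRestrict.1 hφ)

theorem IsMPC.expMax_le {G : ProbabilityMeasure Θ} (h : IsMPC F G) (v : ℝ) :
    expMax G v ≤ expMax F v :=
  h (fun x => max x v) (ConvexOn.sup (convexOn_id (convex_Icc 0 1)) (convexOn_const v (convex_Icc 0 1)))
    (by fun_prop)

/-- The barycenter of `F` on a set, with Jensen's inequality. -/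
theorem exists_barycenter (F : ProbabilityMeasure Θ) (s : Set Θ) :
    ∃ a : Θ, (F : Measure Θ).real s * a = ∫ θ in s, (θ : ℝ) ∂(F : Measure Θ) ∧
      ∀ φ : ℝ → ℝ, ConvexOn ℝ (Set.Icc 0 1) φ → ContinuousOn φ (Set.Icc 0 1) →
        (F : Measure Θ).real s * φ a ≤ ∫ θ in s, φ θ ∂(F : Measure Θ) := by
  by_cases hs : (F : Measure Θ) s = 0
  -- On a null set both sides vanish, so any point serves as barycenter.
  · refine ⟨0, ?_, fun φ _ _ => ?_⟩
    · rw [Measure.restrict_eq_zero.2 hs]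
      simp [Measure.real, hs]
    · rw [Measure.restrict_eq_zero.2 hs]
      simp [Measure.real, hs]
  have hs' : 0 < (F : Measure Θ).real s := ENNReal.toReal_pos hs (measure_ne_top _ _)
  have hint : ∀ {f : Θ → ℝ}, Continuous f → IntegrableOn f s (F : Measure Θ) := fun hf =>
    (integrable_of_continuous F hf).integrableOn
  have hmem : (⨍ θ in s, (θ : ℝ) ∂(F : Measure Θ)) ∈ Set.Icc (0 : ℝ) 1 :=
    Convex.set_average_mem (convex_Icc 0 1) isClosed_Icc hs (measure_ne_top _ _)
      (ae_of_all _ fun θ : Θ => θ.2) (hint continuous_subtype_val)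
  refine ⟨⟨_, hmem⟩, ?_, fun φ hφ hc => ?_⟩
  · simp only [setAverage_eq, smul_eq_mul]
    field_simp
  · have := hφ.map_set_average_le hc isClosed_Icc hs (measure_ne_top _ _)
      (ae_of_all _ fun θ : Θ => θ.2) (hint continuous_subtype_val)
      (integrable_convex F hc).integrableOn
    rw [setAverage_eq _ (fun θ : Θ => φ θ), smul_eq_mul, ← div_eq_inv_mul, le_div_iff₀ hs'] at this
    rw [mul_comm]
    exact this

theorem isMPC_self (F : ProbabilityMeasure Θ) : IsMPC F F := fun _ _ _ => le_rfl

theorem map_priorMean_le {φ : ℝ → ℝ} (hφ : ConvexOn ℝ (Set.Icc 0 1) φ)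
    (hc : ContinuousOn φ (Set.Icc 0 1)) : φ (priorMean F) ≤ ∫ θ : Θ, φ θ ∂(F : Measure Θ) := by
  obtain ⟨a, ha, hJ⟩ := exists_barycenter F Set.univ
  have : (a : ℝ) = priorMean F := by
    simpa [priorMean] using ha
  have h2 := hJ φ hφ hc
  rw [this] at h2
  simpa using h2

theorem max_priorMean_le (F : ProbabilityMeasure Θ) (v : ℝ) :
    max (priorMean F) v ≤ expMax F v :=
  map_priorMean_le (φ := fun x => max x v)
    (ConvexOn.sup (convexOn_id (convex_Icc 0 1)) (convexOn_const v (convex_Icc 0 1)))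
    (by fun_prop)

/-- The mixture of two distributions. -/
def mixture (s : unitInterval) (G G' : ProbabilityMeasure Θ) : ProbabilityMeasure Θ :=
  ⟨ENNReal.ofReal (1 - s) • (G : Measure Θ) + ENNReal.ofReal s • (G' : Measure Θ), ⟨by
    simp only [Measure.add_apply, Measure.smul_apply, measure_univ, smul_eq_mul, mul_one]
    rw [← ENNReal.ofReal_add (by linarith [s.2.2]) s.2.1]
    simp⟩⟩

theorem integral_mixture (s : unitInterval) (G G' : ProbabilityMeasure Θ) {f : Θ → ℝ}
    (hf : Integrable f (G : Measure Θ)) (hf' : Integrable f (G' : Measure Θ)) :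
    ∫ m, f m ∂(mixture s G G' : Measure Θ) =
      (1 - s) * ∫ m, f m ∂(G : Measure Θ) + s * ∫ m, f m ∂(G' : Measure Θ) := by
  have : (mixture s G G' : Measure Θ) =
    ENNReal.ofReal (1 - s) • (G : Measure Θ) + ENNReal.ofReal s • (G' : Measure Θ) := rfl
  rw [this, integral_add_measure (hf.smul_measure ENNReal.ofReal_ne_top)
    (hf'.smul_measure ENNReal.ofReal_ne_top), integral_smul_measure, integral_smul_measure,
    ENNReal.toReal_ofReal (by linarith [s.2.2]), ENNReal.toReal_ofReal s.2.1]
  rfl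

theorem lintegral_mixture (s : unitInterval) (G G' : ProbabilityMeasure Θ) (f : Θ → ℝ≥0∞) :
    ∫⁻ m, f m ∂(mixture s G G' : Measure Θ) =
      ENNReal.ofReal (1 - s) * ∫⁻ m, f m ∂(G : Measure Θ) +
        ENNReal.ofReal s * ∫⁻ m, f m ∂(G' : Measure Θ) := by
  have : (mixture s G G' : Measure Θ) =
    ENNReal.ofReal (1 - s) • (G : Measure Θ) + ENNReal.ofReal s • (G' : Measure Θ) := rfl
  rw [this, lintegral_add_measure, lintegral_smul_measure, lintegral_smul_measure]
  rfl

/-- The point mass at `a`. -/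
def pointMass (a : Θ) : ProbabilityMeasure Θ := ⟨Measure.dirac a, inferInstance⟩

theorem isMPC_pointMass (F : ProbabilityMeasure Θ) : IsMPC F (pointMass (priorPoint F)) := by
  intro φ hφ hc
  change ∫ m : Θ, φ m ∂(Measure.dirac (priorPoint F)) ≤ _
  rw [integral_dirac]
  exact map_priorMean_le hφ hc

theorem IsMPC.mixture {G G' : ProbabilityMeasure Θ} (hG : IsMPC F G) (hG' : IsMPC F G')
    (s : unitInterval) : IsMPC F (mixture s G G') := by
  intro φ hφ hc
  rw [integral_mixture s G G' (integrable_convex G hc) (integrable_convex G' hc)]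
  have h1 := mul_le_mul_of_nonneg_left (hG φ hφ hc) (show 0 ≤ 1 - (s : ℝ) by linarith [s.2.2])
  have h2 := mul_le_mul_of_nonneg_left (hG' φ hφ hc) s.2.1
  linarith

/-- Disclosing whether the quality is at least `u` is a mean-preserving contraction. -/
theorem exists_binarySignal (F : ProbabilityMeasure Θ) (u : ℝ) :
    ∃ (s a b : Θ), IsMPC F (mixture s (pointMass a) (pointMass b)) ∧
      (s : ℝ) * (b - u) = excess F u ∧
      (1 - s : ℝ) * a + s * b = priorMean F := by
  set S : Set Θ := {θ | u ≤ (θ : ℝ)} with hS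
  have hSm : MeasurableSet S := measurableSet_le measurable_const measurable_subtype_coe
  obtain ⟨a, ha, hJa⟩ := exists_barycenter F Sᶜ
  obtain ⟨b, hb, hJb⟩ := exists_barycenter F S
  have hs : (F : Measure Θ).real Sᶜ = 1 - (F : Measure Θ).real S := probReal_compl_eq_one_sub hSm
  rw [hs] at ha hJa
  -- The two posterior means are the barycenters of `F` on either side of `u`, weighted by their
  -- probabilities. Jensen's inequality on each side gives the contraction property.
  refine ⟨⟨(F : Measure Θ).real S, measureReal_nonneg, measureReal_le_one⟩, a, b,
    fun φ hφ hc => ?_, ?_, ?_⟩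
  · rw [integral_mixture _ _ _ (integrable_convex _ hc) (integrable_convex _ hc)]
    have h1 : ∀ x : Θ, ∫ m : Θ, φ m ∂(pointMass x : Measure Θ) = φ x := fun x => by
      change ∫ m : Θ, φ m ∂(Measure.dirac x) = _
      rw [integral_dirac]
    rw [h1, h1, ← integral_add_compl hSm (integrable_convex F hc)]
    have := hJa φ hφ hc
    have := hJb φ hφ hc
    dsimp only
    linarith
  · dsimp only
    rw [mul_sub, hb]
    have h1 : excess F u = ∫ θ in S, ((θ : ℝ) - u) ∂(F : Measure Θ) := by
      unfold excess
      rw [← integral_indicator hSm]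
      congr 1
      funext θ
      by_cases h : θ ∈ S
      · rw [Set.indicator_of_mem h]
        exact max_eq_left (sub_nonneg.2 h)
      · rw [Set.indicator_of_notMem h]
        exact max_eq_right (by rw [hS, Set.mem_ofPred_eq, not_le] at h; linarith)
    rw [h1, integral_sub (integrable_of_continuous F (by fun_prop)).integrableOn
      (integrable_const _).integrableOn]
    simp
  · dsimp only
    rw [ha, hb, add_comm, integral_add_compl hSm (integrable_of_continuous F (by fun_prop))]
    rfl

theorem lintegral_max_eq (G : ProbabilityMeasure Θ) (v : ℝ) :
    ∫⁻ m : Θ, max (ENNReal.ofReal (m : ℝ)) (ENNReal.ofReal v) ∂(G : Measure Θ) =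
      ENNReal.ofReal (expMax G v) := by
  unfold expMax
  rw [ofReal_integral_eq_lintegral_ofReal (integrable_of_continuous G (by fun_prop))
    (ae_of_all _ fun m => le_max_of_le_left m.2.1)]
  simp_rw [ENNReal.ofReal_max]

/-- No signal beats full information. -/
theorem lintegral_max_signalLaw_le (O : Offers F n) (w : Choice n) (v : ℝ) :
    ∫⁻ m : Θ, max (ENNReal.ofReal (m : ℝ)) (ENNReal.ofReal v) ∂(signalLaw O w) ≤
      ENNReal.ofReal (expMax F v) := by
  cases w with
  | none =>
    have := lintegral_max_eq (pointMass (priorPoint F)) v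
    change ∫⁻ m : Θ, _ ∂(pointMass (priorPoint F) : Measure Θ) ≤ _
    rw [this]
    exact ENNReal.ofReal_le_ofReal ((isMPC_pointMass F).expMax_le v)
  | some i =>
    change ∫⁻ m : Θ, _ ∂(((O i).2 : ProbabilityMeasure Θ) : Measure Θ) ≤ _
    rw [lintegral_max_eq]
    exact ENNReal.ofReal_le_ofReal ((O i).2.2.expMax_le v)

/-! ### The threshold -/

theorem not_ae_eq_const (hF : (F : Measure Θ) ≪ volume) (c : ℝ) :
    ¬ ∀ᵐ θ : Θ ∂(F : Measure Θ), (θ : ℝ) = c := by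
  intro h
  have h1 : (volume : Measure Θ) {θ : Θ | (θ : ℝ) = c} = 0 := by
    refine Set.Subsingleton.measure_zero (fun x hx y hy => ?_) _
    exact Subtype.ext (hx.trans hy.symm)
  have h2 := hF h1
  have h3 : (F : Measure Θ) Set.univ = 0 := by
    rw [← Set.union_compl_self {θ : Θ | (θ : ℝ) = c}]
    exact measure_union_null h2 h
  simp at h3

theorem priorMean_pos (hF : (F : Measure Θ) ≪ volume) : 0 < priorMean F := by
  refine lt_of_le_of_ne (priorMean_mem F).1 fun h => not_ae_eq_const hF 0 ?_
  exact (integral_eq_zero_iff_of_nonneg (fun θ : Θ => θ.2.1)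
    (integrable_of_continuous F continuous_subtype_val)).1 h.symm

/-- Otherwise `θ ≤ v` almost surely with `v = E max(θ, m)`, so `max(θ, m)` never exceeds its own
mean and equals `v` almost surely. Whether `m < v` or `m = v`, this makes `θ` almost surely
constant, which absolute continuity excludes. The lemma makes the threshold positive. -/
theorem excess_expMax_pos (hF : (F : Measure Θ) ≪ volume) :
    0 < excess F (expMax F (priorMean F)) := by
  set v := expMax F (priorMean F) with hv
  refine lt_of_le_of_ne (excess_nonneg _ _) fun h => not_ae_eq_const hF v ?_
  have h1 : ∀ᵐ θ : Θ ∂(F : Measure Θ), max ((θ : ℝ) - v) 0 = 0 :=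
    (integral_eq_zero_iff_of_nonneg (f := fun θ : Θ => max ((θ : ℝ) - v) 0)
      (fun _ => le_max_right _ _) (integrable_of_continuous F (by fun_prop))).1 h.symm
  have hmv : priorMean F ≤ v := (le_max_left _ _).trans (max_priorMean_le F _)
  have hle : ∀ᵐ θ : Θ ∂(F : Measure Θ), (θ : ℝ) ≤ v := by
    filter_upwards [h1] with θ hθ
    linarith [le_max_left ((θ : ℝ) - v) 0]
  have h2 : ∀ᵐ θ : Θ ∂(F : Measure Θ), v - max (θ : ℝ) (priorMean F) = 0 := by
    refine (integral_eq_zero_iff_of_nonneg_ae ?_ (integrable_of_continuous F (by fun_prop))).1 ?_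
    · filter_upwards [hle] with θ hθ
      exact sub_nonneg.2 (max_le hθ hmv)
    · rw [integral_sub (integrable_const _) (integrable_of_continuous F (by fun_prop))]
      simp [hv, expMax]
  rcases hmv.lt_or_eq with hlt | heq
  · filter_upwards [h2] with θ hθ
    rcases max_choice (θ : ℝ) (priorMean F) with hm | hm <;> rw [hm] at hθ <;> linarith
  · have h3 : ∀ᵐ θ : Θ ∂(F : Measure Θ), v - (θ : ℝ) = 0 := by
      refine (integral_eq_zero_iff_of_nonneg_ae ?_
        (integrable_of_continuous F (by fun_prop))).1 ?_
      · filter_upwards [hle] with θ hθ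
        exact sub_nonneg.2 hθ
      · rw [integral_sub (integrable_const _) (integrable_of_continuous F (by fun_prop)), ← heq]
        simp [priorMean]
    filter_upwards [h3] with θ hθ
    linarith

/-- The search cost up to which a full-information draw with the autarky continuation is worth
no more than the McCall payoff. -/
theorem exists_threshold (hF : (F : Measure Θ) ≪ volume) :
    ∃ κ : ℝ, 0 < κ ∧ κ < priorMean F ∧
      (∀ k, 0 < k → k ≤ κ → expMax F (autarky F k) ≤ mcCall F k) ∧
      (∀ k, κ < k → k < priorMean F → mcCall F k < expMax F (autarky F k)) := by
  have hm := priorMean_pos hF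
  set H : ℝ → ℝ := fun k => excess F (expMax F (autarky F k)) - k with hH
  have hcont : Continuous H := by
    have h1 : Continuous (autarky F) := by unfold autarky; fun_prop
    exact ((continuous_excess F).comp ((continuous_expMax F).comp h1)).sub continuous_id
  -- Raising `k` lowers the autarky payoff by the same amount. Both `expMax` and `excess` are
  -- 1-Lipschitz, so the first term of `H` rises by at most `k' - k`, which the term `-k` offsets.
  have hanti : ∀ {k k'}, k ≤ k' → H k' ≤ H k := by
    intro k k' hkk
    have h1 : expMax F (autarky F k') ≤ expMax F (autarky F k) :=
      expMax_mono (by unfold autarky; linarith)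
    have h2 := excess_le_add (F := F) h1
    have h3 := excess_anti (F := F) (show autarky F k' ≤ autarky F k by unfold autarky; linarith)
    have h4 : expMax F (autarky F k) - expMax F (autarky F k') ≤ k' - k := by
      rw [expMax_eq, expMax_eq]
      unfold autarky at *
      linarith
    simp only [hH]
    linarith
  have hpos : ∀ k, 0 ≤ k → excess F (expMax F (priorMean F)) - k ≤ H k := by
    intro k hk
    have : excess F (expMax F (priorMean F)) ≤ excess F (expMax F (autarky F k)) :=
      excess_anti (expMax_mono (by unfold autarky; linarith))
    simp only [hH]
    linarith
  -- At `k = m` the autarky payoff is `0`, so `H m = excess F m - m ≤ (1 - m) m - m < 0`.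
  have hmneg : H (priorMean F) < 0 := by
    have h1 : expMax F (autarky F (priorMean F)) = priorMean F := by
      rw [expMax_eq]
      simp [autarky, excess_of_nonpos]
    have h2 := mul_excess_le (F := F) (priorMean_mem F).1 (priorMean_mem F).2
    rw [excess_of_nonpos le_rfl] at h2
    simp only [hH, h1]
    nlinarith
  -- A positive point with `H e ≥ 0`, which keeps the greatest such point away from `0`.
  set e := min (excess F (expMax F (priorMean F))) (priorMean F) with he
  have hepos : 0 < e := lt_min (excess_expMax_pos hF) hm
  have heS : e ∈ Set.Icc 0 (priorMean F) ∩ {k | 0 ≤ H k} := by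
    refine ⟨⟨hepos.le, min_le_right _ _⟩, ?_⟩
    have := hpos e hepos.le
    have h2 : e ≤ excess F (expMax F (priorMean F)) := min_le_left _ _
    simp only [Set.mem_ofPred_eq]
    linarith
  obtain ⟨κ, ⟨hκ1, hκ2⟩, hκ3⟩ := (isCompact_Icc.inter_right
    (isClosed_le continuous_const hcont)).exists_isGreatest ⟨e, heS⟩
  simp only [Set.mem_ofPred_eq] at hκ2
  have hκm : κ < priorMean F := by
    refine lt_of_le_of_ne hκ1.2 fun h => ?_
    rw [h] at hκ2
    linarith
  refine ⟨κ, hepos.trans_le (hκ3 heS), hκm, fun k hk hkκ => ?_, fun k hkκ hkm => ?_⟩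
  · refine le_mcCall hk (hkκ.trans_lt hκm) ?_
    have := hanti hkκ
    simp only [hH] at this hκ2
    linarith
  · have hk : 0 < k := hκ1.1.trans_lt hkκ
    refine mcCall_lt hk hkm ?_
    by_contra h
    have : k ≤ κ := hκ3 ⟨⟨hk.le, hkm.le⟩, by
      simp only [hH, Set.mem_ofPred_eq]
      linarith⟩
    linarith

/-! ### Equilibrium payoffs are feasible -/

theorem Profile.iterate_next_add (σ : Profile F n) {g g' : ∀ t, Hist F n t → ℝ≥0∞}
    (hg : ∀ t, Measurable (g t)) (s t : ℕ) (h : Hist F n t) :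
    σ.next^[s] (fun t h => g t h + g' t h) t h = σ.next^[s] g t h + σ.next^[s] g' t h := by
  induction s generalizing t with
  | zero => rfl
  | succ s ih =>
    simp only [Function.iterate_succ_apply']
    rw [← σ.next_add (σ.measurable_iterate_next hg s)]
    congr 1
    funext t h
    exact ih t h

theorem Profile.total_add (σ : Profile F n) {g g' : ∀ t, Hist F n t → ℝ≥0∞}
    (hg : ∀ t, Measurable (g t)) (t : ℕ) (h : Hist F n t) :
    σ.total (fun t h => g t h + g' t h) t h = σ.total g t h + σ.total g' t h := by
  unfold Profile.total
  rw [← ENNReal.tsum_add]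
  exact tsum_congr fun s => σ.iterate_next_add hg s t h

theorem Profile.total_sum (σ : Profile F n) {ι : Type*} (S : Finset ι)
    {g : ι → ∀ t, Hist F n t → ℝ≥0∞} (hg : ∀ i t, Measurable (g i t)) (t : ℕ) (h : Hist F n t) :
    σ.total (fun t h => ∑ i ∈ S, g i t h) t h = ∑ i ∈ S, σ.total (g i) t h := by
  classical
  induction S using Finset.induction_on with
  | empty => simpa using σ.total_zero t h
  | insert i S hi ih =>
    simp_rw [Finset.sum_insert hi]
    rw [σ.total_add (hg i), ih]

/-- Prices cancel between the brokers' revenue and the agent's outlay. What remains is one draw with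
outside option `u̅`, worth at most `E max(θ, u̅) = u̅ + k` under any signal. -/
theorem Profile.sum_revenue_add_le (σ : Profile F n) {k : ℝ} (hk : 0 < k)
    (hk' : k < priorMean F) (t : ℕ) (h : Hist F n t) (O : Offers F n) :
    ∑ i, σ.buyProb t h O (some i) * ((O i).1 : ℝ≥0∞) +
      (σ.consumeAt t h O + σ.nextAt (fun _ _ => ENNReal.ofReal (mcCall F k)) t h O) ≤
      σ.outlayAt k t h O + ENNReal.ofReal (mcCall F k) := by
  have h1 : σ.outlayAt k t h O =
      ENNReal.ofReal k + ∑ i, σ.buyProb t h O (some i) * ((O i).1 : ℝ≥0∞) := by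
    unfold Profile.outlayAt
    rw [Fintype.sum_option]
    simp [price]
  have h2 : σ.consumeAt t h O + σ.nextAt (fun _ _ => ENNReal.ofReal (mcCall F k)) t h O ≤
      ENNReal.ofReal (mcCall F k) + ENNReal.ofReal k := by
    rw [σ.consumeAt_add_nextAt, ← ENNReal.ofReal_add (excess_mcCall hk hk').2.1.le hk.le,
      ← expMax_mcCall hk hk']
    calc _ ≤ ∑ w, σ.buyProb t h O w * ENNReal.ofReal (expMax F (mcCall F k)) := by
          gcongr with w
          exact (lintegral_mono fun m => σ.stop_add_cont_le_max t h O w m _ _).trans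
            (lintegral_max_signalLaw_le O w _)
      _ = _ := by rw [← Finset.sum_mul, σ.sum_buyProb, one_mul]
  rw [h1]
  calc _ ≤ _ := add_le_add_right h2 _
    _ = _ := by ring

/-- Total surplus never exceeds the McCall payoff. -/
theorem Profile.surplus_le (σ : Profile F n) {k : ℝ} (hk : 0 < k) (hk' : k < priorMean F)
    (t : ℕ) (h : Hist F n t) :
    ∑ i, σ.brokerPayoff i t h + σ.quality t h ≤
      σ.outlay k t h + ENNReal.ofReal (mcCall F k) := by
  have hR : ∀ t, Measurable (fun h => ∑ i, σ.revenue i t h) := fun t =>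
    Finset.measurable_fun_sum _ fun i _ => σ.measurable_revenue i t
  have key := σ.total_le_total_add
    (a := fun t h => ∑ i, σ.revenue i t h + ∫⁻ O, σ.consumeAt t h O ∂(σ.offersLaw t h))
    (c := fun t h => ∫⁻ O, σ.outlayAt k t h O ∂(σ.offersLaw t h))
    (W := fun _ _ => ENNReal.ofReal (mcCall F k))
    (fun t => (hR t).add (σ.measurable_consume t)) (σ.measurable_periodOutlay k)
    (fun t h => ?_) t h
  · rw [σ.total_add hR, σ.total_sum _ σ.measurable_revenue] at key
    exact key
  · have hm : ∀ i, Measurable fun O => σ.buyProb t h O (some i) * ((O i).1 : ℝ≥0∞) := fun i =>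
      ((σ.measurable_buyProb t (some i)).comp measurable_prodMk_left).mul
        (measurable_price (some i))
    unfold Profile.next Profile.revenue
    rw [← lintegral_finsetSum _ fun i _ => hm i, add_assoc,
      ← lintegral_add_left (σ.measurable_consumeAt_right t h),
      ← lintegral_add_left (Finset.measurable_fun_sum _ fun i _ => hm i)]
    calc _ ≤ ∫⁻ O, (σ.outlayAt k t h O + ENNReal.ofReal (mcCall F k)) ∂(σ.offersLaw t h) :=
          lintegral_mono fun O => σ.sum_revenue_add_le hk hk' t h O
      _ = _ := by
        rw [lintegral_add_right _ measurable_const]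
        simp

/-- The agent never buys and consumes the first good. -/
def autarkyStrategy (F : ProbabilityMeasure Θ) (n : ℕ) : AgentStrategy F n where
  buy _ := Kernel.const _ (Measure.dirac none)
  markov _ := inferInstance
  cont _ _ := 0
  measurable_cont _ := measurable_const

theorem Profile.autarkyStrategy_quality (σ : Profile F n) (t : ℕ) (h : Hist F n t) :
    (σ.withAgent (autarkyStrategy F n)).quality t h = ENNReal.ofReal (priorMean F) := by
  unfold Profile.quality
  rw [Profile.total_eq _ (Profile.measurable_consume _)]
  simp [Profile.next, Profile.nextAt, Profile.contProb, Profile.withAgent, autarkyStrategy,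
    Profile.consumeAt, Profile.buyProb, Profile.stopProb, Fintype.sum_option, signalLaw,
    priorPoint, lintegral_dirac' _ measurable_quality_coe]

theorem Profile.autarkyStrategy_outlay (σ : Profile F n) (k : ℝ) (t : ℕ) (h : Hist F n t) :
    (σ.withAgent (autarkyStrategy F n)).outlay k t h = ENNReal.ofReal k := by
  unfold Profile.outlay
  rw [Profile.total_eq _ (Profile.measurable_periodOutlay _ k)]
  simp [Profile.next, Profile.nextAt, Profile.contProb, Profile.withAgent, autarkyStrategy,
    Profile.outlayAt, Profile.buyProb, Fintype.sum_option, price]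

/-- Compare with the deviation that takes the null offer and stops at once. Its finite payoff also
excludes an infinite equilibrium outlay, so the inequality between differences can be rearranged. -/
theorem IsEquilibrium.outlay_add_autarky_le {σ : Profile F n} {k : ℝ} (H : IsEquilibrium k σ)
    (hk : 0 < k) (hk' : k < priorMean F) (t : ℕ) (h : Hist F n t) :
    σ.outlay k t h + ENNReal.ofReal (autarky F k) ≤ σ.quality t h := by
  have h1 := H.agent t h (autarkyStrategy F n)
  have h2 : (σ.withAgent (autarkyStrategy F n)).agentPayoff k t h =
      (ENNReal.ofReal (autarky F k) : EReal) := by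
    unfold Profile.agentPayoff
    rw [σ.autarkyStrategy_quality, σ.autarkyStrategy_outlay]
    refine ereal_sub_eq ?_ ENNReal.ofReal_ne_top
    rw [← ENNReal.ofReal_add hk.le (by unfold autarky; linarith)]
    congr 1
    unfold autarky
    ring
  rw [h2] at h1
  have ho : σ.outlay k t h ≠ ⊤ := by
    intro ho
    unfold Profile.agentPayoff at h1
    rw [ho, EReal.coe_ennreal_top, EReal.sub_top, le_bot_iff] at h1
    exact EReal.coe_ennreal_ne_bot _ h1
  have := add_le_add_of_ereal_sub_le_sub (q := ENNReal.ofReal (autarky F k)) (o := 0)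
    (q' := σ.quality t h) (o' := σ.outlay k t h) (by simpa [Profile.agentPayoff] using h1)
    (by simp) ho
  rw [add_zero] at this
  rwa [add_comm]

theorem IsEquilibrium.outlay_le_one {σ : Profile F n} {k : ℝ} (H : IsEquilibrium k σ)
    (hk : 0 < k) (hk' : k < priorMean F) (t : ℕ) (h : Hist F n t) : σ.outlay k t h ≤ 1 :=
  le_self_add.trans ((H.outlay_add_autarky_le hk hk' t h).trans (σ.quality_le_one t h))

theorem coe_ennreal_eq_coe_real {x : ℝ≥0∞} {y : ℝ} (h : (x : EReal) = (y : EReal)) :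
    0 ≤ y ∧ x = ENNReal.ofReal y := by
  have hy : 0 ≤ y := by
    have : (0 : EReal) ≤ (y : EReal) := h ▸ EReal.coe_ennreal_nonneg x
    exact_mod_cast this
  refine ⟨hy, ?_⟩
  rw [← EReal.coe_ennreal_eq_coe_ennreal_iff, h, EReal.coe_ennreal_ofReal, max_eq_left hy]

theorem coe_ennreal_ofReal_of_nonneg {y : ℝ} (hy : 0 ≤ y) :
    ((ENNReal.ofReal y : ℝ≥0∞) : EReal) = (y : EReal) := by
  rw [EReal.coe_ennreal_ofReal, max_eq_left hy]

theorem equilibriumPayoffs_subset {k : ℝ} (hk : 0 < k) (hk' : k < priorMean F) :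
    equilibriumPayoffs F n k ⊆ feasiblePayoffs F n k := by
  rintro y ⟨σ, H, hB, hA⟩
  have hq := H.outlay_add_autarky_le hk hk' 0 Fin.elim0
  have ho1 := H.outlay_le_one hk hk' 0 Fin.elim0
  have hS := σ.surplus_le hk hk' 0 Fin.elim0
  have hq1 := σ.quality_le_one 0 Fin.elim0
  have hau : 0 < autarky F k := by unfold autarky; linarith
  unfold Profile.agentPayoff at hA
  generalize σ.outlay k 0 Fin.elim0 = o at *
  generalize σ.quality 0 Fin.elim0 = q at *
  lift o to ℝ≥0 using ne_top_of_le_ne_top ENNReal.one_ne_top ho1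
  lift q to ℝ≥0 using ne_top_of_le_ne_top ENNReal.one_ne_top hq1
  have hA' : (q : ℝ) - o = y (Fin.last n) := by
    simp only [EReal.coe_nnreal_eq_coe_real] at hA
    exact_mod_cast hA
  have hq' : (o : ℝ) + autarky F k ≤ q := by
    have := ENNReal.toReal_mono ENNReal.coe_ne_top hq
    rwa [ENNReal.toReal_add ENNReal.coe_ne_top ENNReal.ofReal_ne_top, ENNReal.coe_toReal,
      ENNReal.toReal_ofReal hau.le, ENNReal.coe_toReal] at this
  have hB0 : ∀ i : Fin n, 0 ≤ y i.castSucc := fun i => (coe_ennreal_eq_coe_real (hB i)).1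
  have hB1 : ∑ i, σ.brokerPayoff i 0 Fin.elim0 = ENNReal.ofReal (∑ i : Fin n, y i.castSucc) := by
    rw [ENNReal.ofReal_sum_of_nonneg fun i _ => hB0 i]
    exact Finset.sum_congr rfl fun i _ => (coe_ennreal_eq_coe_real (hB i)).2
  rw [hB1] at hS
  have hS' : ∑ i : Fin n, y i.castSucc + q ≤ o + mcCall F k := by
    have := ENNReal.toReal_mono (ENNReal.add_ne_top.2 ⟨ENNReal.coe_ne_top,
      ENNReal.ofReal_ne_top⟩) hS
    rwa [ENNReal.toReal_add ENNReal.coe_ne_top ENNReal.ofReal_ne_top,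
      ENNReal.toReal_add ENNReal.ofReal_ne_top ENNReal.coe_ne_top,
      ENNReal.toReal_ofReal (excess_mcCall hk hk').2.1.le,
      ENNReal.toReal_ofReal (Finset.sum_nonneg fun i _ => hB0 i)] at this
  refine ⟨fun j => ?_, by linarith, ?_⟩
  · refine Fin.lastCases ?_ hB0 j
    linarith
  · rw [Fin.sum_univ_castSucc]
    linarith

/-! ### Offers are distinguishable -/

theorem pi_dirac {ι : Type*} [Fintype ι] {α : ι → Type*} [∀ i, MeasurableSpace (α i)]
    (x : ∀ i, α i) : Measure.pi (fun i => Measure.dirac (x i)) = Measure.dirac x := by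
  classical
  refine Measure.pi_eq fun s hs => ?_
  rw [Measure.dirac_apply' _ (MeasurableSet.univ_pi hs)]
  simp_rw [fun i => Measure.dirac_apply' (x i) (hs i)]
  simp only [Set.indicator_apply, Set.mem_univ_pi, Pi.one_apply]
  rw [Finset.prod_ite_zero]
  simp

theorem ext_of_Iic_rat {G G' : ProbabilityMeasure Θ}
    (h : ∀ a : ℚ, (G : Measure Θ) {m | (m : ℝ) ≤ a} = (G' : Measure Θ) {m | (m : ℝ) ≤ a}) :
    G = G' := by
  have hval : MeasurableEmbedding (Subtype.val : Θ → ℝ) :=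
    MeasurableEmbedding.subtype_coe measurableSet_Icc
  have hmap : (G : Measure Θ).map Subtype.val = (G' : Measure Θ).map Subtype.val := by
    have : IsFiniteMeasure ((G : Measure Θ).map Subtype.val) := inferInstance
    refine ext_of_generate_finite (⋃ a : ℚ, {Set.Iic (a : ℝ)})
      ((BorelSpace.measurable_eq).trans Real.borel_eq_generateFrom_Iic_rat)
      Real.isPiSystem_Iic_rat ?_ ?_
    · intro s hs
      obtain ⟨a, ha⟩ := Set.mem_iUnion.1 hs
      rw [Set.mem_singleton_iff.1 ha, hval.map_apply, hval.map_apply]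
      exact h a
    · rw [hval.map_apply, hval.map_apply]
      simp
  have h2 : (G : Measure Θ) = (G' : Measure Θ) := by
    rw [← hval.comap_map (G : Measure Θ), hmap, hval.comap_map]
  exact Subtype.ext h2

/-- The folk strategies ask whether every broker made exactly the prescribed offer. That event must
be measurable, and it is because countably many values of the distribution function determine a
signal. -/
instance : MeasurableSingletonClass (Signal F) where
  measurableSet_singleton G := by
    have : ({G} : Set (Signal F)) = ⋂ a : ℚ, {G' : Signal F |
        ((G' : ProbabilityMeasure Θ) : Measure Θ) {m | (m : ℝ) ≤ a} =
          ((G : ProbabilityMeasure Θ) : Measure Θ) {m | (m : ℝ) ≤ a}} := by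
      ext G'
      simp only [Set.mem_singleton_iff, Set.mem_iInter]
      refine ⟨fun h a => ?_, fun h => Subtype.ext (ext_of_Iic_rat h)⟩
      rw [h]
      rfl
    rw [this]
    refine MeasurableSet.iInter fun a => ?_
    have hm : Measurable fun G' : Signal F =>
        ((G' : ProbabilityMeasure Θ) : Measure Θ) {m : Θ | (m : ℝ) ≤ a} :=
      (Measure.measurable_coe (measurableSet_le measurable_subtype_coe measurable_const)).comp
        (measurable_subtype_coe.comp measurable_subtype_coe)
    exact hm (measurableSet_singleton _)

/-! ### The folk equilibrium -/

/-- Phases of the folk equilibrium: the target payoffs are to be delivered; the agent is to receive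
the McCall payoff; the agent is to receive the autarky payoff. -/
inductive Phase
  | target
  | reward
  | punish

instance : MeasurableSpace Phase := ⊤

instance : DiscreteMeasurableSpace Phase := ⟨fun _ => trivial⟩

instance : Finite Phase :=
  Finite.of_injective (fun s : Phase => match s with
    | .target => (0 : Fin 3)
    | .reward => 1
    | .punish => 2) (by rintro (_ | _ | _) (_ | _ | _) h <;> simp_all)

open Classical in
/-- Transition between phases when every broker is to offer `d s` in phase `s`. A deviating offer
is followed by `reward` if the agent turned it down and by `punish` if he did not. -/
def phaseStep (d : Phase → Offer F) (s : Phase) (r : Round F n) : Phase :=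
  if r.1 = fun _ => d s then
    if r.2.1 = none ∨ r.2.2 = priorPoint F then .punish else .reward
  else if r.2.1 = none then .reward else .punish

/-- The phase after a history. -/
def phase (d : Phase → Offer F) : ∀ t, Hist F n t → Phase
  | 0, _ => .target
  | t + 1, h => phaseStep d (phase d t (Fin.init h)) (h (Fin.last t))

theorem phase_snoc (d : Phase → Offer F) (t : ℕ) (h : Hist F n t) (r : Round F n) :
    phase d (t + 1) (Fin.snoc h r) = phaseStep d (phase d t h) r := by
  simp [phase]

/-- The target phase occurs only before the first offers. Continuation values are thus always `u̅`
or `u̲`, and brokers earn nothing after the first period. -/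
theorem phaseStep_ne_target (d : Phase → Offer F) (s : Phase) (r : Round F n) :
    phaseStep d s r ≠ .target := by
  unfold phaseStep
  split_ifs <;> simp

theorem measurable_phaseStep (d : Phase → Offer F) :
    Measurable (fun p : Phase × Round F n => phaseStep d p.1 p.2) := by
  refine measurable_from_prod_countable_right fun s => ?_
  have h1 : MeasurableSet {r : Round F n | r.1 = fun _ => d s} :=
    measurable_fst (measurableSet_singleton (fun _ => d s))
  have h2 : MeasurableSet {r : Round F n | r.2.1 = none} :=
    (measurable_fst.comp measurable_snd) (measurableSet_singleton none)
  have h3 : MeasurableSet {r : Round F n | r.2.2 = priorPoint F} :=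
    (measurable_snd.comp measurable_snd) (measurableSet_singleton (priorPoint F))
  classical
  exact Measurable.ite h1 (Measurable.ite (h2.union h3) measurable_const measurable_const)
    (Measurable.ite h2 measurable_const measurable_const)

theorem measurable_phase (d : Phase → Offer F) (t : ℕ) :
    Measurable (phase d t : Hist F n t → Phase) := by
  induction t with
  | zero => exact measurable_const
  | succ t ih =>
    have h1 : Measurable (fun h : Hist F n (t + 1) => (Fin.init h : Hist F n t)) :=
      measurable_pi_iff.2 fun j => measurable_pi_apply (Fin.castSucc j)
    exact (measurable_phaseStep d).comp ((ih.comp h1).prodMk (measurable_pi_apply (Fin.last t)))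

theorem measurableSet_conform (d : Phase → Offer F) (t : ℕ) :
    MeasurableSet {p : Hist F n t × Offers F n | p.2 = fun _ => d (phase d t p.1)} := by
  have : {p : Hist F n t × Offers F n | p.2 = fun _ => d (phase d t p.1)} =
      ⋃ s : Phase, ({p | phase d t p.1 = s} ∩ {p | p.2 = fun _ => d s}) := by
    ext p
    simp only [Set.mem_iUnion, Set.mem_inter_iff, Set.mem_ofPred_eq]
    exact ⟨fun h => ⟨_, rfl, h⟩, by rintro ⟨s, rfl, h⟩; exact h⟩
  rw [this]
  refine MeasurableSet.iUnion fun s => MeasurableSet.inter ?_ ?_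
  · exact ((measurable_phase d t).comp measurable_fst) (measurableSet_singleton s)
  · exact measurable_snd (measurableSet_singleton (fun _ => d s))

open Classical in
/-- The profile in which every broker offers `d s` in phase `s`, the agent buys according to
`β s` as long as no broker deviates and turns down all offers otherwise, and he continues the
search whenever the posterior mean is below the value `v` of the next phase. -/
def folkProfile (d : Phase → Offer F) (β : Phase → PMF (Choice n)) (v : Phase → ℝ) :
    Profile F n where
  broker _ :=
    { offer := fun t => Kernel.deterministic (fun h => d (phase d t h))
        (measurable_from_top.comp (measurable_phase d t))
      markov := fun _ => inferInstance }
  agent :=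
    { buy := fun t => ⟨fun p => if p.2 = fun _ => d (phase d t p.1) then
          (β (phase d t p.1)).toMeasure else Measure.dirac none,
        Measurable.ite (measurableSet_conform d t)
          ((measurable_from_top (f := fun s => (β s).toMeasure)).comp
            ((measurable_phase d t).comp measurable_fst)) measurable_const⟩
      markov := fun t => ⟨fun p => by
        simp only [Kernel.coe_mk]
        split_ifs <;> infer_instance⟩
      cont := fun t p =>
        if (p.2.2.2 : ℝ) < v (phaseStep d (phase d t p.1) p.2) then 1 else 0
      measurable_cont := fun t => by
        refine Measurable.ite (measurableSet_lt ?_ ?_) measurable_const measurable_const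
        · exact measurable_subtype_coe.comp
            (measurable_snd.comp (measurable_snd.comp measurable_snd))
        · exact measurable_from_top.comp ((measurable_phaseStep d).comp
            (((measurable_phase d t).comp measurable_fst).prodMk measurable_snd)) }

section Folk

variable {d : Phase → Offer F} {β : Phase → PMF (Choice n)} {v : Phase → ℝ} {k : ℝ}

theorem folkProfile_offersLaw (t : ℕ) (h : Hist F n t) :
    (folkProfile d β v).offersLaw t h = Measure.dirac (fun _ => d (phase d t h)) := by
  unfold Profile.offersLaw folkProfile
  simp only [Kernel.deterministic_apply]
  exact pi_dirac _

theorem folkProfile_buyProb_conform (t : ℕ) (h : Hist F n t) (w : Choice n) :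
    (folkProfile d β v).buyProb t h (fun _ => d (phase d t h)) w = β (phase d t h) w := by
  simp [Profile.buyProb, folkProfile]

theorem folkProfile_buyProb_deviation {t : ℕ} {h : Hist F n t} {O : Offers F n}
    (hO : O ≠ fun _ => d (phase d t h)) (w : Choice n) :
    (folkProfile d β v).buyProb t h O w = Measure.dirac (none : Choice n) {w} := by
  simp [Profile.buyProb, folkProfile, hO]

open Classical in
-- The assumption `hd` says that every broker's prescribed offer, gross of its price, is worth
-- exactly the phase's value plus the search cost plus that price. The null offer then yields only
-- `m = u̲ + k`. After a deviation, refusal is worth `u̅`, and `hφ` makes every acceptance worth no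
-- more.
theorem folkProfile_bellmanAttained (hk : 0 < k) (hk' : k < priorMean F)
    (hv : ∀ s, autarky F k ≤ v s) (hv1 : ∀ s, v s ≤ 1) (hvr : v .reward = mcCall F k)
    (hvp : v .punish = autarky F k) (hβ : ∀ s, β s none = 0)
    (hd : ∀ s, ∫⁻ m : Θ, max (ENNReal.ofReal (m : ℝ))
      (ENNReal.ofReal (v (if m = priorPoint F then .punish else .reward)))
        ∂((d s).2 : Measure Θ) = ENNReal.ofReal (v s + k) + (d s).1)
    (hφ : expMax F (autarky F k) ≤ mcCall F k) :
    (folkProfile d β v).BellmanAttained k (fun t h => ENNReal.ofReal (v (phase d t h)))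
      (fun t h O => if O = fun _ => d (phase d t h) then ENNReal.ofReal (v (phase d t h) + k)
        else ENNReal.ofReal (mcCall F k)) where
  measurable t := ENNReal.measurable_ofReal.comp
    (measurable_from_top.comp (measurable_phase d t))
  optimal t h O w := by
    simp only [phase_snoc]
    split_ifs with hO
    · cases w with
      | none =>
        simp only [signalLaw, phaseStep, hO, if_true, true_or, hvp]
        rw [lintegral_dirac]
        refine le_add_right (max_le (ENNReal.ofReal_le_ofReal ?_) (ENNReal.ofReal_le_ofReal ?_))
        · have := hv (phase d t h)
          unfold autarky at this
          simp only [priorPoint]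
          linarith
        · linarith [hv (phase d t h)]
      | some i =>
        subst hO
        simp only [phaseStep, if_true, reduceCtorEq, false_or]
        exact (hd _).le
    · cases w with
      | none =>
        simp only [signalLaw, phaseStep, hO, if_true, if_false, hvr]
        rw [lintegral_dirac]
        refine le_add_right (max_le (ENNReal.ofReal_le_ofReal ?_) le_rfl)
        exact ((le_max_left _ _).trans (max_priorMean_le F _)).trans hφ
      | some i =>
        -- Accepting any offer after a deviation leads to value `u̲`; even full information for free
        -- is then worth at most `E max(θ, u̲) ≤ u̅`.
        simp only [phaseStep, hO, if_false, reduceCtorEq, hvp]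
        exact le_add_right ((lintegral_max_signalLaw_le O (some i) _).trans
          (ENNReal.ofReal_le_ofReal hφ))
  offers t h := by
    rw [folkProfile_offersLaw, lintegral_dirac, if_pos rfl, add_comm (v _),
      ENNReal.ofReal_add hk.le]
    refine le_trans ?_ (hv _)
    unfold autarky
    linarith
  le_one t h := ENNReal.ofReal_le_one.2 (hv1 _)
  buy t h O w hw := by
    simp only [phase_snoc]
    split_ifs with hO
    · subst hO
      rw [folkProfile_buyProb_conform] at hw
      cases w with
      | none => exact absurd (hβ _) hw
      | some i =>
        simp only [phaseStep, if_true, reduceCtorEq, false_or]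
        exact hd _
    · rw [folkProfile_buyProb_deviation hO] at hw
      cases w with
      | none =>
        simp only [signalLaw, phaseStep, hO, if_true, if_false, hvr]
        rw [lintegral_dirac, max_eq_right]
        · simp [price]
        · exact ENNReal.ofReal_le_ofReal
            (((le_max_left _ _).trans (max_priorMean_le F _)).trans hφ)
      | some i => simp at hw
  stopping t h O w m := by
    simp only [phase_snoc, Profile.stopProb, Profile.contProb, folkProfile]
    split_ifs with hm
    · simp [max_eq_right (ENNReal.ofReal_le_ofReal hm.le)]
    · simp [max_eq_left (ENNReal.ofReal_le_ofReal (not_lt.1 hm))]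

open Classical in
/-- The brokers' payoffs in the folk equilibrium. -/
def folkValue (d : Phase → Offer F) (β : Phase → PMF (Choice n)) (i : Fin n) (t : ℕ)
    (h : Hist F n t) : ℝ≥0∞ :=
  if phase d t h = .target then β .target (some i) * ((d .target).1 : ℝ≥0∞) else 0

theorem measurable_folkValue (i : Fin n) (t : ℕ) : Measurable (folkValue d β i t) := by
  classical
  have hS : MeasurableSet {h : Hist F n t | phase d t h = .target} :=
    (measurable_phase d t) (measurableSet_singleton Phase.target)
  exact Measurable.ite hS
    measurable_const measurable_const

theorem folkProfile_nextAt_folkValue (i : Fin n) (t : ℕ) (h : Hist F n t) (O : Offers F n) :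
    (folkProfile d β v).nextAt (folkValue d β i) t h O = 0 := by
  simp [Profile.nextAt, folkValue, phase_snoc, phaseStep_ne_target]

/-- A deviating offer is never bought and leads to a phase without revenue. Outside the target phase
conforming offers are free, so nothing can be earned there either. -/
theorem folkProfile_brokerPayoff_le (hp : ∀ s, s ≠ .target → (d s).1 = 0) (i : Fin n)
    (τ : BrokerStrategy F n) (t : ℕ) (h : Hist F n t) :
    ((folkProfile d β v).withBroker i τ).brokerPayoff i t h ≤ folkValue d β i t h := by
  refine Profile.brokerPayoff_withBroker_le (measurable_folkValue i) (fun t h O => ?_) τ t h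
  rw [folkProfile_nextAt_folkValue, add_zero]
  by_cases hO : O = fun _ => d (phase d t h)
  · subst hO
    rw [folkProfile_buyProb_conform]
    unfold folkValue
    split_ifs with hs
    · rw [hs]
    · simp [hp _ hs]
  · rw [folkProfile_buyProb_deviation hO]
    simp

theorem folkValue_le_brokerPayoff (i : Fin n) (t : ℕ) (h : Hist F n t) :
    folkValue d β i t h ≤ (folkProfile d β v).brokerPayoff i t h := by
  unfold folkValue
  split_ifs with hs
  · unfold Profile.brokerPayoff
    rw [Profile.total_eq _ (Profile.measurable_revenue _ i)]
    refine le_add_right ?_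
    unfold Profile.revenue
    rw [folkProfile_offersLaw, lintegral_dirac, folkProfile_buyProb_conform, hs]
  · exact zero_le

theorem withBroker_self (σ : Profile F n) (i : Fin n) : σ.withBroker i (σ.broker i) = σ := by
  unfold Profile.withBroker
  rw [Function.update_eq_self]

theorem folkProfile_brokerPayoff (hp : ∀ s, s ≠ .target → (d s).1 = 0) (i : Fin n) (t : ℕ)
    (h : Hist F n t) :
    (folkProfile d β v).brokerPayoff i t h = folkValue d β i t h := by
  refine le_antisymm ?_ (folkValue_le_brokerPayoff i t h)
  have := folkProfile_brokerPayoff_le (β := β) (v := v) hp i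
    ((folkProfile d β v).broker i) t h
  rwa [withBroker_self] at this

end Folk

/-- The realization `m` is `F`-null, so it signals the point-mass component, where the agent stops
with `m = u̲ + k`. Any other realization comes from the full-information component, where
continuation value `u̅` yields `E max(θ, u̅) = u̅ + k`. -/
theorem mixture_continuation_value (hF : (F : Measure Θ) ≪ volume) (s : unitInterval)
    {k : ℝ} (hk : 0 < k) (hk' : k < priorMean F) (v : Phase → ℝ)
    (hvr : v .reward = mcCall F k) (hvp : v .punish = autarky F k) [DecidableEq Θ] :
    ∫⁻ m : Θ, max (ENNReal.ofReal (m : ℝ))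
      (ENNReal.ofReal (v (if m = priorPoint F then .punish else .reward)))
        ∂(mixture s (pointMass (priorPoint F)) F : Measure Θ) =
      ENNReal.ofReal (autarky F k + s * (mcCall F k - autarky F k) + k) := by
  have hu := (excess_mcCall hk hk').2.1
  rw [lintegral_mixture]
  have h1 : ∫⁻ m : Θ, max (ENNReal.ofReal (m : ℝ))
      (ENNReal.ofReal (v (if m = priorPoint F then .punish else .reward)))
        ∂(pointMass (priorPoint F) : Measure Θ) = ENNReal.ofReal (priorMean F) := by
    change ∫⁻ m : Θ, _ ∂(Measure.dirac (priorPoint F)) = _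
    rw [lintegral_dirac, if_pos rfl, hvp, max_eq_left]
    · rfl
    · exact ENNReal.ofReal_le_ofReal (by simp only [priorPoint, autarky]; linarith)
  have h2 : ∫⁻ m : Θ, max (ENNReal.ofReal (m : ℝ))
      (ENNReal.ofReal (v (if m = priorPoint F then .punish else .reward)))
        ∂(F : Measure Θ) = ENNReal.ofReal (mcCall F k + k) := by
    rw [← expMax_mcCall hk hk', ← lintegral_max_eq]
    refine lintegral_congr_ae ?_
    have h3 : (F : Measure Θ) {priorPoint F} = 0 :=
      hF (Set.Subsingleton.measure_zero Set.subsingleton_singleton _)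
    have h4 : ∀ᵐ m ∂(F : Measure Θ), m ≠ priorPoint F := by
      rw [ae_iff]
      simpa using h3
    filter_upwards [h4] with m hm
    rw [if_neg hm, hvr]
  rw [h1, h2, ← ENNReal.ofReal_mul (by linarith [s.2.2]), ← ENNReal.ofReal_mul s.2.1,
    ← ENNReal.ofReal_add (mul_nonneg (by linarith [s.2.2]) (by linarith))
      (mul_nonneg s.2.1 (by linarith))]
  congr 1
  unfold autarky
  ring

/-- Shares of the total price that the brokers are to earn. -/
theorem exists_shares (hn : 0 < n) {y : Fin n → ℝ} (hy : ∀ i, 0 ≤ y i) :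
    ∃ β : PMF (Choice n), β none = 0 ∧
      ∀ i, β (some i) * ENNReal.ofReal (∑ j, y j) = ENNReal.ofReal (y i) := by
  rcases (Finset.sum_nonneg fun i (_ : i ∈ Finset.univ) => hy i).eq_or_lt with h0 | hpos
  -- If nothing is to be earned the shares are arbitrary, but the agent must still buy from some
  -- broker, since the null offer would trigger punishment.
  · refine ⟨PMF.pure (some ⟨0, hn⟩), by simp, fun i => ?_⟩
    have : y i = 0 := (Finset.sum_eq_zero_iff_of_nonneg fun i _ => hy i).1 h0.symm i
      (Finset.mem_univ i)
    rw [← h0, this]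
    simp
  · refine ⟨PMF.ofFintype (fun w => match w with
      | none => 0
      | some i => ENNReal.ofReal (y i / ∑ j, y j)) ?_, ?_, fun i => ?_⟩
    · rw [Fintype.sum_option, zero_add,
        ← ENNReal.ofReal_sum_of_nonneg fun i _ => div_nonneg (hy i) hpos.le,
        ← Finset.sum_div, div_self hpos.ne', ENNReal.ofReal_one]
    · simp
    · rw [PMF.ofFintype_apply, ← ENNReal.ofReal_mul (div_nonneg (hy i) hpos.le),
        div_mul_cancel₀ _ hpos.ne']

/-- The folk theorem: below the threshold all feasible payoffs are equilibrium payoffs. -/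
theorem feasiblePayoffs_subset (hF : (F : Measure Θ) ≪ volume) (hn : 0 < n) {k : ℝ} (hk : 0 < k)
    (hk' : k < priorMean F) (hφ : expMax F (autarky F k) ≤ mcCall F k) :
    feasiblePayoffs F n k ⊆ equilibriumPayoffs F n k := by
  classical
  rintro y ⟨hy0, hya, hys⟩
  rw [Fin.sum_univ_castSucc] at hys
  obtain ⟨-, hu0, hu1⟩ := excess_mcCall hk hk'
  have hgap : autarky F k < mcCall F k := by
    have : priorMean F ≤ mcCall F k :=
      ((le_max_left _ _).trans (max_priorMean_le F _)).trans hφ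
    unfold autarky
    linarith
  set P : ℝ := ∑ i : Fin n, y i.castSucc with hP
  have hP0 : 0 ≤ P := Finset.sum_nonneg fun i _ => hy0 _
  obtain ⟨β, hβ0, hβ⟩ := exists_shares hn (y := fun i : Fin n => y i.castSucc) fun i => hy0 _
  -- The weight on full information at which total surplus `u̲ + l (u̅ - u̲)` equals the sum of the
  -- target payoffs; feasibility places it in `[0, 1]`.
  let l : unitInterval := ⟨(y (Fin.last n) + P - autarky F k) / (mcCall F k - autarky F k),
    div_nonneg (by linarith) (by linarith), (div_le_one (by linarith)).2 (by linarith)⟩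
  have hl : (l : ℝ) * (mcCall F k - autarky F k) = y (Fin.last n) + P - autarky F k :=
    div_mul_cancel₀ _ (by linarith)
  let sig : unitInterval → Signal F := fun s =>
    ⟨mixture s (pointMass (priorPoint F)) F, (isMPC_pointMass F).mixture (isMPC_self F) s⟩
  let d : Phase → Offer F := fun s => match s with
    | .target => (P.toNNReal, sig l)
    | .reward => (0, sig 1)
    | .punish => (0, sig 0)
  let v : Phase → ℝ := fun s => match s with
    | .target => y (Fin.last n)
    | .reward => mcCall F k
    | .punish => autarky F k
  let b : Phase → PMF (Choice n) := fun _ => β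
  have hp : ∀ s, s ≠ Phase.target → (d s).1 = 0 := by
    rintro (_ | _ | _) h
    · exact absurd rfl h
    · rfl
    · rfl
  have H : (folkProfile d b v).BellmanAttained k _ _ :=
    folkProfile_bellmanAttained (d := d) (β := b) (v := v) hk hk'
      (by rintro (_ | _ | _)
          · exact hya
          · exact hgap.le
          · exact le_rfl)
      (by rintro (_ | _ | _)
          · change y (Fin.last n) ≤ 1; linarith
          · exact hu1.le
          · exact hgap.le.trans hu1.le)
      rfl rfl (fun _ => hβ0)
      (by
        have hau : 0 < autarky F k := by unfold autarky; linarith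
        rintro (_ | _ | _)
        · refine (mixture_continuation_value hF l hk hk' v rfl rfl).trans ?_
          change _ = ENNReal.ofReal (y (Fin.last n) + k) + ENNReal.ofReal P
          rw [hl, ← ENNReal.ofReal_add (by linarith) hP0]
          congr 1
          ring
        · refine (mixture_continuation_value hF 1 hk hk' v rfl rfl).trans ?_
          change _ = ENNReal.ofReal (mcCall F k + k) + ((0 : ℝ≥0) : ℝ≥0∞)
          simp
        · refine (mixture_continuation_value hF 0 hk hk' v rfl rfl).trans ?_
          change _ = ENNReal.ofReal (autarky F k + k) + ((0 : ℝ≥0) : ℝ≥0∞)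
          simp)
      hφ
  refine ⟨folkProfile d b v, ⟨fun i t h τ => ?_, H.agent hk, H.agent_purchase hk,
    H.agent_stopping hk⟩, fun i => ?_, ?_⟩
  · rw [folkProfile_brokerPayoff hp]
    exact folkProfile_brokerPayoff_le hp i τ t h
  · rw [folkProfile_brokerPayoff hp]
    have : folkValue d b i 0 Fin.elim0 = ENNReal.ofReal (y i.castSucc) := by
      rw [← hβ i]
      exact if_pos rfl
    rw [this, coe_ennreal_ofReal_of_nonneg (hy0 _)]
  · rw [H.agentPayoff_eq hk]
    exact coe_ennreal_ofReal_of_nonneg (hy0 _)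

/-! ### The full-extraction equilibrium of the monopolist -/

theorem lintegral_pointMass (a : Θ) (f : Θ → ℝ≥0∞) :
    ∫⁻ m, f m ∂(pointMass a : Measure Θ) = f a :=
  lintegral_dirac a f

/-- The monopolist's signal discloses whether the quality exceeds the McCall payoff. -/
structure IsExtractionSignal (F : ProbabilityMeasure Θ) (k : ℝ) (s a b : Θ) : Prop where
  isMPC : IsMPC F (mixture s (pointMass a) (pointMass b))
  pos : 0 < (s : ℝ)
  lt_high : mcCall F k < b
  low : (1 - s : ℝ) * (autarky F k - a) = s * (mcCall F k - autarky F k)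
  high : (s : ℝ) * (b - mcCall F k) = k

theorem exists_extractionSignal {k : ℝ} (hk : 0 < k) (hk' : k < priorMean F) :
    ∃ s a b, IsExtractionSignal F k s a b := by
  obtain ⟨s, a, b, h1, h2, h3⟩ := exists_binarySignal F (mcCall F k)
  rw [(excess_mcCall hk hk').1] at h2
  have hs : 0 < (s : ℝ) := by
    refine lt_of_le_of_ne s.2.1 fun h => ?_
    rw [← h] at h2
    linarith
  refine ⟨s, a, b, h1, hs, ?_, ?_, h2⟩
  · by_contra h
    have := mul_nonneg hs.le (sub_nonneg.2 (not_lt.1 h))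
    linarith
  · unfold autarky
    linarith

namespace IsExtractionSignal

variable {k : ℝ} {s a b : Θ}

theorem low_lt (H : IsExtractionSignal F k s a b) (hlt : autarky F k < mcCall F k) :
    (a : ℝ) < autarky F k := by
  by_contra h
  have h1 := mul_nonneg (sub_nonneg.2 s.2.2) (sub_nonneg.2 (not_lt.1 h))
  have h2 := mul_pos H.pos (sub_pos.2 hlt)
  have := H.low
  linarith

/-- With outside option `u̲` the agent continues after `a` and stops at `b`, so the signal is worth
`s (u̅ - u̲)` more than the null offer. This is the price it can be sold for in every period. -/
theorem expMax_eq (H : IsExtractionSignal F k s a b) (hle : autarky F k ≤ mcCall F k) :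
    expMax (mixture s (pointMass a) (pointMass b)) (autarky F k) =
      priorMean F + s * (mcCall F k - autarky F k) := by
  unfold expMax
  rw [integral_mixture _ _ _ (integrable_of_continuous _ (by fun_prop))
    (integrable_of_continuous _ (by fun_prop))]
  have h1 : ∀ x : Θ, ∫ m : Θ, max (m : ℝ) (autarky F k) ∂(pointMass x : Measure Θ) =
      max (x : ℝ) (autarky F k) := fun x => by
    change ∫ m : Θ, _ ∂(Measure.dirac x) = _
    rw [integral_dirac]
  have h2 : (1 - s : ℝ) * max (a : ℝ) (autarky F k) = (1 - s) * autarky F k := by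
    rcases hle.eq_or_lt with heq | hlt
    · have h3 := H.low
      rw [heq, sub_self, mul_zero, mul_eq_zero] at h3
      rcases h3 with h3 | h3
      · rw [h3, zero_mul, zero_mul]
      · rw [heq, max_eq_right (by linarith)]
    · rw [max_eq_right (H.low_lt hlt).le]
  rw [h1, h1, h2, max_eq_left (by linarith [H.lt_high])]
  have := H.high
  unfold autarky at *
  linarith

end IsExtractionSignal

open Classical in
/-- The monopolist always offers `o`; the agent expects the autarky payoff and buys whenever this
is worth its price. -/
def extractionProfile (k : ℝ) (o : Offer F) : Profile F 1 where
  broker _ :=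
    { offer := fun _ => Kernel.const _ (Measure.dirac o)
      markov := fun _ => inferInstance }
  agent :=
    { buy := fun t => ⟨fun p => if ENNReal.ofReal (priorMean F) + price p.2 (some 0) ≤
          ∫⁻ m : Θ, max (ENNReal.ofReal (m : ℝ)) (ENNReal.ofReal (autarky F k))
            ∂(signalLaw p.2 (some 0)) then Measure.dirac (some 0) else Measure.dirac none,
        Measurable.ite (measurableSet_le
            (measurable_const.add ((measurable_price (some 0)).comp measurable_snd))
            (measurable_lintegral_signalLaw (some 0)
              ((measurable_quality_coe.comp measurable_snd).max measurable_const)))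
          measurable_const measurable_const⟩
      markov := fun t => ⟨fun p => by
        simp only [Kernel.coe_mk]
        split_ifs <;> infer_instance⟩
      cont := fun t p => if (p.2.2.2 : ℝ) < autarky F k then 1 else 0
      measurable_cont := fun t => by
        refine Measurable.ite (measurableSet_lt ?_ measurable_const) measurable_const
          measurable_const
        exact measurable_subtype_coe.comp
          (measurable_snd.comp (measurable_snd.comp measurable_snd)) }

section Extraction

variable {k : ℝ} {o : Offer F}

/-- The agent's value of the monopolist's offer, gross of its price. -/
def offerValue (k : ℝ) (O : Offers F 1) : ℝ≥0∞ :=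
  ∫⁻ m : Θ, max (ENNReal.ofReal (m : ℝ)) (ENNReal.ofReal (autarky F k)) ∂(signalLaw O (some 0))

theorem extractionProfile_buyProb_of_le {t : ℕ} {h : Hist F 1 t} {O : Offers F 1}
    (hO : ENNReal.ofReal (priorMean F) + price O (some 0) ≤ offerValue k O) (w : Choice 1) :
    (extractionProfile k o).buyProb t h O w = Measure.dirac (some 0 : Choice 1) {w} := by
  unfold offerValue at hO
  simp only [Profile.buyProb, extractionProfile, Kernel.coe_mk]
  rw [if_pos hO]

theorem extractionProfile_buyProb_of_lt {t : ℕ} {h : Hist F 1 t} {O : Offers F 1}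
    (hO : ¬ ENNReal.ofReal (priorMean F) + price O (some 0) ≤ offerValue k O) (w : Choice 1) :
    (extractionProfile k o).buyProb t h O w = Measure.dirac (none : Choice 1) {w} := by
  unfold offerValue at hO
  simp only [Profile.buyProb, extractionProfile, Kernel.coe_mk]
  rw [if_neg hO]

theorem extractionProfile_offersLaw (t : ℕ) (h : Hist F 1 t) :
    (extractionProfile k o).offersLaw t h = Measure.dirac (fun _ => o) := by
  unfold Profile.offersLaw extractionProfile
  simp only [Kernel.const_apply]
  exact pi_dirac _

open Classical in
theorem extractionProfile_contProb (t : ℕ) (h : Hist F 1 t) (O : Offers F 1) (w : Choice 1)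
    (m : Θ) : (extractionProfile k o).contProb t h O w m =
      if (m : ℝ) < autarky F k then 1 else 0 := by
  simp only [Profile.contProb, extractionProfile]
  split_ifs <;> simp

open Classical in
theorem extractionProfile_stopProb (t : ℕ) (h : Hist F 1 t) (O : Offers F 1) (w : Choice 1)
    (m : Θ) : (extractionProfile k o).stopProb t h O w m =
      if (m : ℝ) < autarky F k then 0 else 1 := by
  simp only [Profile.stopProb, extractionProfile]
  split_ifs <;> simp

/-- With constant continuation value `u̲`, the null offer is worth `m`, and by `ho` the monopolist's
price leaves the agent exactly indifferent. The truncated subtraction is harmless under the maximum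
with `m`. -/
theorem extractionProfile_bellmanAttained (hk : 0 < k) (hk' : k < priorMean F)
    (ho : offerValue k (fun _ => o) = ENNReal.ofReal (priorMean F) + o.1) :
    (extractionProfile k o).BellmanAttained k (fun _ _ => ENNReal.ofReal (autarky F k))
      (fun _ _ O => max (ENNReal.ofReal (priorMean F)) (offerValue k O - price O (some 0))) where
  measurable _ := measurable_const
  optimal t h O w := by
    cases w with
    | none =>
      simp only [signalLaw]
      rw [lintegral_dirac]
      refine le_add_right (le_max_of_le_left (max_le le_rfl (ENNReal.ofReal_le_ofReal ?_)))
      unfold autarky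
      linarith
    | some i =>
      obtain rfl := Subsingleton.elim i 0
      exact le_tsub_add.trans (add_le_add_left (le_max_right _ _) _)
  offers t h := by
    rw [extractionProfile_offersLaw, lintegral_dirac, ho]
    simp only [price]
    rw [ENNReal.add_sub_cancel_right ENNReal.coe_ne_top, max_self,
      ← ENNReal.ofReal_add hk.le (by unfold autarky; linarith)]
    congr 1
    unfold autarky
    ring
  le_one t h := ENNReal.ofReal_le_one.2 (by unfold autarky; linarith [(priorMean_mem F).2])
  buy t h O w hw := by
    by_cases hO : ENNReal.ofReal (priorMean F) + price O (some 0) ≤ offerValue k O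
    · rw [extractionProfile_buyProb_of_le hO] at hw
      cases w with
      | none => simp at hw
      | some i =>
        obtain rfl := Subsingleton.elim i 0
        rw [max_eq_right (ENNReal.le_sub_of_add_le_right ENNReal.coe_ne_top hO),
          tsub_add_cancel_of_le (le_add_self.trans hO)]
        rfl
    · rw [extractionProfile_buyProb_of_lt hO] at hw
      cases w with
      | none =>
        rw [max_eq_left (tsub_le_iff_right.2 (not_le.1 hO).le)]
        simp only [signalLaw, price]
        rw [lintegral_dirac, max_eq_left]
        · simp [priorPoint]
        · exact ENNReal.ofReal_le_ofReal (by simp only [priorPoint, autarky]; linarith)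
      | some i => simp at hw
  stopping t h O w m := by
    rw [extractionProfile_contProb, extractionProfile_stopProb]
    split_ifs with hm
    · simp [max_eq_right (ENNReal.ofReal_le_ofReal hm.le)]
    · simp [max_eq_left (ENNReal.ofReal_le_ofReal (not_lt.1 hm))]

/-- No offer earns the monopolist more than the surplus over autarky. -/
theorem extractionProfile_revenue_le (hk : 0 < k) (hk' : k < priorMean F) (t : ℕ)
    (h : Hist F 1 t) (O : Offers F 1) :
    (extractionProfile k o).buyProb t h O (some 0) * ((O 0).1 : ℝ≥0∞) +
      (extractionProfile k o).nextAt
        (fun _ _ => ENNReal.ofReal (mcCall F k - autarky F k)) t h O ≤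
      ENNReal.ofReal (mcCall F k - autarky F k) := by
  classical
  have hle := autarky_le_mcCall hk hk'
  have hau : 0 < autarky F k := by unfold autarky; linarith
  unfold Profile.nextAt
  rw [Fintype.sum_option, Fin.sum_univ_one]
  simp_rw [extractionProfile_contProb]
  by_cases hO : ENNReal.ofReal (priorMean F) + price O (some 0) ≤ offerValue k O
  · simp_rw [extractionProfile_buyProb_of_le hO]
    simp only [Measure.dirac_apply, Set.indicator_apply, Set.mem_singleton_iff, reduceCtorEq,
      if_false, if_true, Pi.one_apply, one_mul, zero_mul, zero_add]
    -- A sale requires `m + price ≤ E max(·, u̲)`. Adding `u̅ - u̲` on the event of continuation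
    -- gives at most `E max(·, u̅) ≤ u̅ + k = m + (u̅ - u̲)`.
    refine (ENNReal.add_le_add_iff_left (a := ENNReal.ofReal (priorMean F))
      ENNReal.ofReal_ne_top).1 ?_
    calc _ ≤ offerValue k O + ∫⁻ m : Θ, (if (m : ℝ) < autarky F k then 1 else 0) *
          ENNReal.ofReal (mcCall F k - autarky F k) ∂(signalLaw O (some 0)) := by
          rw [← add_assoc]
          exact add_le_add_left hO _
      _ = ∫⁻ m : Θ, (max (ENNReal.ofReal (m : ℝ)) (ENNReal.ofReal (autarky F k)) +
          (if (m : ℝ) < autarky F k then 1 else 0) *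
          ENNReal.ofReal (mcCall F k - autarky F k)) ∂(signalLaw O (some 0)) := by
          rw [lintegral_add_left (measurable_quality_coe.max measurable_const)]
          rfl
      _ ≤ ∫⁻ m : Θ, max (ENNReal.ofReal (m : ℝ)) (ENNReal.ofReal (mcCall F k))
            ∂(signalLaw O (some 0)) := by
          refine lintegral_mono fun m => ?_
          dsimp only
          split_ifs with hm
          · rw [max_eq_right (ENNReal.ofReal_le_ofReal hm.le), one_mul,
              ← ENNReal.ofReal_add hau.le (by linarith)]
            simp
          · rw [max_eq_left (ENNReal.ofReal_le_ofReal (not_lt.1 hm)), zero_mul, add_zero]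
            exact le_max_left _ _
      _ ≤ ENNReal.ofReal (expMax F (mcCall F k)) := lintegral_max_signalLaw_le O _ _
      _ = _ := by
          rw [expMax_mcCall hk hk', ← ENNReal.ofReal_add (by linarith) (by linarith)]
          congr 1
          unfold autarky
          ring
  · simp_rw [extractionProfile_buyProb_of_lt hO]
    simp only [Measure.dirac_apply, Set.indicator_apply, Set.mem_singleton_iff, reduceCtorEq,
      if_false, if_true, Pi.one_apply, one_mul, zero_mul, zero_add, add_zero, signalLaw]
    rw [lintegral_dirac, if_neg (by simp only [priorPoint, autarky]; linarith), zero_mul]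
    exact zero_le

theorem extraction_mem {k : ℝ} (hk : 0 < k) (hk' : k < priorMean F) :
    ![mcCall F k - autarky F k, autarky F k] ∈ equilibriumPayoffs F 1 k := by
  classical
  obtain ⟨s, a, b, hS⟩ := exists_extractionSignal hk hk'
  have hle := autarky_le_mcCall hk hk'
  have hau : 0 < autarky F k := by unfold autarky; linarith
  obtain ⟨-, hu0, hu1⟩ := excess_mcCall hk hk'
  set D := mcCall F k - autarky F k with hD
  have hD0 : 0 ≤ D := sub_nonneg.2 hle
  let o : Offer F := ((s * D).toNNReal, ⟨_, hS.isMPC⟩)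
  have hval : offerValue k (fun _ => o) = ENNReal.ofReal (priorMean F) + o.1 := by
    refine (lintegral_max_eq (mixture s (pointMass a) (pointMass b)) (autarky F k)).trans ?_
    rw [hS.expMax_eq hle, ENNReal.ofReal_add (by linarith) (mul_nonneg s.2.1 hD0)]
    rfl
  have H := extractionProfile_bellmanAttained hk hk' hval
  have hbuy : ∀ t (h : Hist F 1 t) w, (extractionProfile k o).buyProb t h (fun _ => o) w =
      Measure.dirac (some 0 : Choice 1) {w} := fun t h w =>
    extractionProfile_buyProb_of_le (by rw [hval]; rfl) w
  -- With `D = u̅ - u̲`, a period yields the price `s D`, and search continues after `a`, hence with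
  -- probability `1 - s` at least: `s D + (1 - s) D = D`.
  have hstep : ∀ t (h : Hist F 1 t), (0 : ℝ≥0∞) + ENNReal.ofReal D ≤
      (extractionProfile k o).revenue 0 t h +
        (extractionProfile k o).next (fun _ _ => ENNReal.ofReal D) t h := by
    intro t h
    unfold Profile.revenue Profile.next Profile.nextAt
    rw [extractionProfile_offersLaw, lintegral_dirac, lintegral_dirac, Fintype.sum_option,
      Fin.sum_univ_one]
    simp_rw [hbuy, extractionProfile_contProb]
    simp only [Measure.dirac_apply, Set.indicator_apply, Set.mem_singleton_iff, reduceCtorEq,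
      if_false, if_true, Pi.one_apply, one_mul, zero_mul, zero_add]
    change _ ≤ ENNReal.ofReal (s * D) +
      ∫⁻ m, _ ∂(mixture s (pointMass a) (pointMass b) : Measure Θ)
    rw [lintegral_mixture, lintegral_pointMass, lintegral_pointMass]
    rcases hle.eq_or_lt with heq | hlt
    · simp [hD, heq]
    · rw [if_pos (hS.low_lt hlt), one_mul, ← ENNReal.ofReal_mul (by linarith [s.2.2]), ← add_assoc,
        ← ENNReal.ofReal_add (mul_nonneg s.2.1 hD0) (mul_nonneg (by linarith [s.2.2]) hD0)]
      refine le_add_right (ENNReal.ofReal_le_ofReal ?_)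
      linarith
  have hB : ∀ t (h : Hist F 1 t),
      (extractionProfile k o).brokerPayoff 0 t h = ENNReal.ofReal D := by
    intro t h
    refine le_antisymm ?_ ?_
    · have := Profile.brokerPayoff_withBroker_le (σ := extractionProfile k o) (i := 0)
        (fun _ => measurable_const) (extractionProfile_revenue_le hk hk')
        ((extractionProfile k o).broker 0) t h
      rwa [withBroker_self] at this
    -- The lower bound needs transversality: the uncollected remainder vanishes because search ends
    -- almost surely.
    · have h1 := (H.tendsto_iterate_next hk (g := fun _ _ => ENNReal.ofReal D)
        (fun _ _ => ENNReal.ofReal_le_one.2 (by linarith)) t h).const_add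
        ((extractionProfile k o).brokerPayoff 0 t h)
      rw [add_zero] at h1
      refine ge_of_tendsto' h1 fun N => ?_
      have h2 := (extractionProfile k o).le_partialTotal_add (c := fun _ _ => 0)
        ((extractionProfile k o).measurable_revenue 0) (fun _ => measurable_const) hstep N t h
      refine (le_add_self.trans h2).trans ?_
      gcongr
      exact Profile.partialTotal_le _ _ N t h
  refine ⟨extractionProfile k o, ⟨fun i t h τ => ?_, H.agent hk, H.agent_purchase hk,
    H.agent_stopping hk⟩, fun i => ?_, ?_⟩
  · obtain rfl := Subsingleton.elim i 0
    rw [hB]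
    exact Profile.brokerPayoff_withBroker_le (fun _ => measurable_const)
      (extractionProfile_revenue_le hk hk') τ t h
  · obtain rfl := Subsingleton.elim i 0
    rw [hB, coe_ennreal_ofReal_of_nonneg hD0]
    simp
  · rw [H.agentPayoff_eq hk, coe_ennreal_ofReal_of_nonneg hau.le]
    simp [Fin.last]

end Extraction

/-! ### Deviations in a single period -/

/-- The profiles `σ` and `σ'` prescribe the same behavior from period `T` on. -/
structure Profile.AgreesFrom (σ σ' : Profile F n) (T : ℕ) : Prop where
  offersLaw : ∀ t, T ≤ t → σ.offersLaw t = σ'.offersLaw t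
  buy : ∀ t, T ≤ t → σ.agent.buy t = σ'.agent.buy t
  cont : ∀ t, T ≤ t → σ.agent.cont t = σ'.agent.cont t

namespace Profile

variable {σ σ' : Profile F n} {T : ℕ}

theorem AgreesFrom.next_congr (H : σ.AgreesFrom σ' T) {g g' : ∀ t, Hist F n t → ℝ≥0∞} {t : ℕ}
    (ht : T ≤ t) (hg : ∀ h, g (t + 1) h = g' (t + 1) h) (h : Hist F n t) :
    σ.next g t h = σ'.next g' t h := by
  unfold next nextAt buyProb contProb
  rw [H.offersLaw t ht, H.buy t ht, H.cont t ht]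
  simp_rw [hg]

theorem AgreesFrom.total_congr (H : σ.AgreesFrom σ' T) {g g' : ∀ t, Hist F n t → ℝ≥0∞}
    (hg : ∀ t, T ≤ t → ∀ h, g t h = g' t h) {t : ℕ} (ht : T ≤ t) (h : Hist F n t) :
    σ.total g t h = σ'.total g' t h := by
  refine tsum_congr fun s => ?_
  induction s generalizing t with
  | zero => exact hg t ht h
  | succ s ih =>
    rw [Function.iterate_succ_apply', Function.iterate_succ_apply']
    exact H.next_congr ht (fun h => ih (by omega) h) h

theorem AgreesFrom.quality_eq (H : σ.AgreesFrom σ' T) {t : ℕ} (ht : T ≤ t) (h : Hist F n t) :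
    σ.quality t h = σ'.quality t h := by
  refine H.total_congr (fun t ht h => ?_) ht h
  unfold consumeAt buyProb stopProb
  rw [H.offersLaw t ht, H.buy t ht, H.cont t ht]

theorem AgreesFrom.outlay_eq (H : σ.AgreesFrom σ' T) (k : ℝ) {t : ℕ} (ht : T ≤ t)
    (h : Hist F n t) : σ.outlay k t h = σ'.outlay k t h := by
  refine H.total_congr (fun t ht h => ?_) ht h
  unfold outlayAt buyProb
  rw [H.offersLaw t ht, H.buy t ht]

theorem AgreesFrom.brokerPayoff_eq (H : σ.AgreesFrom σ' T) (i : Fin n) {t : ℕ} (ht : T ≤ t)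
    (h : Hist F n t) : σ.brokerPayoff i t h = σ'.brokerPayoff i t h := by
  refine H.total_congr (fun t ht h => ?_) ht h
  unfold revenue buyProb
  rw [H.offersLaw t ht, H.buy t ht]

end Profile

/-- In period `T` the agent takes the purchase decision `w`; otherwise he follows `α`. -/
def AgentStrategy.buyOnce (α : AgentStrategy F n) (T : ℕ) (w : Choice n) : AgentStrategy F n where
  buy t := if t = T then Kernel.const _ (Measure.dirac w) else α.buy t
  markov t := by
    split_ifs
    · infer_instance
    · exact α.markov t
  cont := α.cont
  measurable_cont := α.measurable_cont

/-- In period `T` the agent continues with probability `c`; otherwise he follows `α`. -/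
def AgentStrategy.contOnce (α : AgentStrategy F n) (T : ℕ) (c : unitInterval) :
    AgentStrategy F n where
  buy := α.buy
  markov := α.markov
  cont t := if t = T then fun _ => c else α.cont t
  measurable_cont t := by
    split_ifs
    · exact measurable_const
    · exact α.measurable_cont t

/-- In period `T` the broker offers `o`; otherwise she follows `β`. -/
def BrokerStrategy.offerOnce (β : BrokerStrategy F n) (T : ℕ) (o : Offer F) :
    BrokerStrategy F n where
  offer t := if t = T then Kernel.const _ (Measure.dirac o) else β.offer t
  markov t := by
    split_ifs
    · infer_instance
    · exact β.markov t

namespace Profile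

variable (σ : Profile F n)

theorem agreesFrom_buyOnce (T : ℕ) (w : Choice n) :
    (σ.withAgent (σ.agent.buyOnce T w)).AgreesFrom σ (T + 1) where
  offersLaw _ _ := rfl
  buy t ht := if_neg (by omega)
  cont _ _ := rfl

theorem agreesFrom_contOnce (T : ℕ) (c : unitInterval) :
    (σ.withAgent (σ.agent.contOnce T c)).AgreesFrom σ (T + 1) where
  offersLaw _ _ := rfl
  buy _ _ := rfl
  cont t ht := if_neg (by omega)

theorem agreesFrom_offerOnce (i : Fin n) (T : ℕ) (o : Offer F) :
    (σ.withBroker i ((σ.broker i).offerOnce T o)).AgreesFrom σ (T + 1) where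
  offersLaw t ht := by
    funext h
    unfold offersLaw withBroker
    congr 1
    funext j
    by_cases hj : j = i
    · subst hj
      simp [BrokerStrategy.offerOnce, show t ≠ T by omega]
    · simp [hj]
  buy _ _ := rfl
  cont _ _ := rfl

end Profile

/-! ### The agent's values in equilibrium -/

/-- The agent's equilibrium payoff as an extended nonnegative number. -/
def Profile.agentValue (σ : Profile F n) (k : ℝ) (t : ℕ) (h : Hist F n t) : ℝ≥0∞ :=
  σ.quality t h - σ.outlay k t h

namespace IsEquilibrium

variable {σ : Profile F n} {k : ℝ}

theorem outlay_ne_top (H : IsEquilibrium k σ) (hk : 0 < k) (hk' : k < priorMean F) (t : ℕ)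
    (h : Hist F n t) : σ.outlay k t h ≠ ⊤ :=
  ne_top_of_le_ne_top ENNReal.one_ne_top (H.outlay_le_one hk hk' t h)

theorem quality_eq (H : IsEquilibrium k σ) (hk : 0 < k) (hk' : k < priorMean F) (t : ℕ)
    (h : Hist F n t) : σ.quality t h = σ.outlay k t h + σ.agentValue k t h :=
  (add_tsub_cancel_of_le (le_self_add.trans (H.outlay_add_autarky_le hk hk' t h))).symm

theorem autarky_le_agentValue (H : IsEquilibrium k σ) (hk : 0 < k) (hk' : k < priorMean F) (t : ℕ)
    (h : Hist F n t) : ENNReal.ofReal (autarky F k) ≤ σ.agentValue k t h :=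
  ENNReal.le_sub_of_add_le_left (H.outlay_ne_top hk hk' t h) (H.outlay_add_autarky_le hk hk' t h)

/-- Compare with the one-period deviations that continue with probability `0` or `1`. From the next
period on they coincide with `σ`, so all outlays are finite and cancel. -/
theorem stop_add_cont_eq (H : IsEquilibrium k σ) (hk : 0 < k) (hk' : k < priorMean F) (t : ℕ)
    (h : Hist F n t) (O : Offers F n) (w : Choice n) (m : Θ) :
    σ.stopProb t h O w m * ENNReal.ofReal (m : ℝ) +
      σ.contProb t h O w m * σ.agentValue k (t + 1) (Fin.snoc h (O, w, m)) =
      max (ENNReal.ofReal (m : ℝ)) (σ.agentValue k (t + 1) (Fin.snoc h (O, w, m))) := by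
  refine le_antisymm (σ.stop_add_cont_le_max t h O w m _ _) ?_
  have ho := H.outlay_ne_top hk hk' (t + 1) (Fin.snoc h (O, w, m))
  have hco : σ.contProb t h O w m * σ.outlay k (t + 1) (Fin.snoc h (O, w, m)) ≠ ⊤ :=
    ENNReal.mul_ne_top (ne_top_of_le_ne_top ENNReal.one_ne_top (σ.contProb_le_one t h O w m)) ho
  have hdev : ∀ c : unitInterval,
      ENNReal.ofReal (1 - c) * ENNReal.ofReal (m : ℝ) +
        ENNReal.ofReal c * σ.quality (t + 1) (Fin.snoc h (O, w, m)) +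
          σ.contProb t h O w m * σ.outlay k (t + 1) (Fin.snoc h (O, w, m)) ≤
      σ.stopProb t h O w m * ENNReal.ofReal (m : ℝ) +
        σ.contProb t h O w m * σ.quality (t + 1) (Fin.snoc h (O, w, m)) +
          ENNReal.ofReal c * σ.outlay k (t + 1) (Fin.snoc h (O, w, m)) := by
    intro c
    have h1 := H.agent_stopping t h O w m (σ.agent.contOnce t c)
    have hA := σ.agreesFrom_contOnce t c
    unfold Profile.agentPayoffAtSignal at h1
    rw [hA.quality_eq le_rfl, hA.outlay_eq k le_rfl] at h1
    have hs : (σ.withAgent (σ.agent.contOnce t c)).stopProb t h O w m = ENNReal.ofReal (1 - c) := by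
      simp [Profile.stopProb, Profile.withAgent, AgentStrategy.contOnce]
    have hc : (σ.withAgent (σ.agent.contOnce t c)).contProb t h O w m = ENNReal.ofReal c := by
      simp [Profile.contProb, Profile.withAgent, AgentStrategy.contOnce]
    rw [hs, hc] at h1
    exact add_le_add_of_ereal_sub_le_sub h1 (ENNReal.mul_ne_top ENNReal.ofReal_ne_top ho) hco
  rw [H.quality_eq hk hk'] at hdev
  refine max_le ?_ ?_
  · have h0 := hdev 0
    simp only [Set.Icc.coe_zero, sub_zero, ENNReal.ofReal_one, one_mul, ENNReal.ofReal_zero,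
      zero_mul, add_zero] at h0
    refine (ENNReal.add_le_add_iff_right hco).1 (h0.trans (le_of_eq ?_))
    ring
  · have h0 := hdev 1
    simp only [Set.Icc.coe_one, sub_self, ENNReal.ofReal_one, one_mul, ENNReal.ofReal_zero,
      zero_mul, zero_add] at h0
    refine (ENNReal.add_le_add_iff_right (ENNReal.add_ne_top.2 ⟨ho, hco⟩)).1 (le_trans (le_of_eq ?_)
      (h0.trans (le_of_eq ?_))) <;> ring

/-- In equilibrium the agent continues after posterior means below his continuation value. -/
theorem contProb_eq_one (H : IsEquilibrium k σ) (hk : 0 < k) (hk' : k < priorMean F) (t : ℕ)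
    (h : Hist F n t) (O : Offers F n) (w : Choice n) {m : Θ} (hm : (m : ℝ) < autarky F k) :
    σ.contProb t h O w m = 1 := by
  have h1 := H.stop_add_cont_eq hk hk' t h O w m
  have h2 := H.autarky_le_agentValue hk hk' (t + 1) (Fin.snoc h (O, w, m))
  have h4 : σ.agentValue k (t + 1) (Fin.snoc h (O, w, m)) ≠ ⊤ :=
    ne_top_of_le_ne_top ENNReal.one_ne_top (tsub_le_self.trans (σ.quality_le_one _ _))
  generalize σ.agentValue k (t + 1) (Fin.snoc h (O, w, m)) = W at *
  have h3 : ENNReal.ofReal (m : ℝ) < W :=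
    lt_of_lt_of_le ((ENNReal.ofReal_lt_ofReal_iff (m.2.1.trans_lt hm)).2 hm) h2
  have h5 := σ.stopProb_add_contProb t h O w m
  rw [max_eq_right h3.le] at h1
  generalize σ.stopProb t h O w m = s at *
  generalize σ.contProb t h O w m = c at *
  have hs : s ≠ ⊤ := ne_top_of_le_ne_top ENNReal.one_ne_top (h5 ▸ le_self_add)
  have hc : c ≠ ⊤ := ne_top_of_le_ne_top ENNReal.one_ne_top (h5 ▸ le_add_self)
  have h6 : s * ENNReal.ofReal (m : ℝ) + c * W = s * W + c * W := by
    rw [h1, ← add_mul, h5, one_mul]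
  have h7 : s * ENNReal.ofReal (m : ℝ) = s * W :=
    (ENNReal.add_left_inj (ENNReal.mul_ne_top hc h4)).1 h6
  have h8 : s = 0 := by
    by_contra h0
    exact h3.ne ((ENNReal.mul_right_inj h0 hs).1 h7)
  rwa [h8, zero_add] at h5

/-- The value of the purchase decision `w`, gross of the price. -/
theorem purchase_le (H : IsEquilibrium k σ) (hk : 0 < k) (hk' : k < priorMean F) (t : ℕ)
    (h : Hist F n t) (O : Offers F n) (w' : Choice n) :
    ∫⁻ m, max (ENNReal.ofReal (m : ℝ)) (σ.agentValue k (t + 1) (Fin.snoc h (O, w', m)))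
        ∂(signalLaw O w') + ∑ w, σ.buyProb t h O w * (price O w : ℝ≥0∞) ≤
      ∑ w, σ.buyProb t h O w * ∫⁻ m, max (ENNReal.ofReal (m : ℝ))
        (σ.agentValue k (t + 1) (Fin.snoc h (O, w, m))) ∂(signalLaw O w) + price O w' := by
  have hq : σ.quality = fun t h => σ.outlay k t h + σ.agentValue k t h := by
    funext t h
    exact H.quality_eq hk hk' t h
  have hA := σ.agreesFrom_buyOnce t w'
  set τ := σ.withAgent (σ.agent.buyOnce t w') with hτ
  have h1 := H.agent_purchase t h O (σ.agent.buyOnce t w')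
  unfold Profile.agentPayoffAtOffers at h1
  rw [← hτ] at h1
  have hfin : ∀ σ' : Profile F n, σ'.nextAt (σ.outlay k) t h O ≠ ⊤ := fun σ' =>
    ne_top_of_le_ne_top ENNReal.one_ne_top (σ'.nextAt_le_one (H.outlay_le_one hk hk') t h O)
  have hnq : τ.nextAt τ.quality t h O = τ.nextAt σ.quality t h O :=
    le_antisymm (τ.nextAt_mono (fun h => (hA.quality_eq le_rfl h).le) h O)
      (τ.nextAt_mono (fun h => (hA.quality_eq le_rfl h).ge) h O)
  have hno : τ.nextAt (τ.outlay k) t h O = τ.nextAt (σ.outlay k) t h O :=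
    le_antisymm (τ.nextAt_mono (fun h => (hA.outlay_eq k le_rfl h).le) h O)
      (τ.nextAt_mono (fun h => (hA.outlay_eq k le_rfl h).ge) h O)
  have hdec : ∀ σ' : Profile F n, σ'.consumeAt t h O + σ'.nextAt σ.quality t h O =
      σ'.nextAt (σ.outlay k) t h O +
        (σ'.consumeAt t h O + σ'.nextAt (σ.agentValue k) t h O) := by
    intro σ'
    rw [hq, σ'.nextAt_add (σ.measurable_outlay k)]
    ring
  rw [hnq, hno, hdec σ, hdec τ] at h1
  have h2 := add_le_add_of_ereal_sub_le_sub h1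
    (ENNReal.add_ne_top.2 ⟨τ.outlayAt_ne_top k t h O, hfin τ⟩)
    (ENNReal.add_ne_top.2 ⟨σ.outlayAt_ne_top k t h O, hfin σ⟩)
  have hs : σ.consumeAt t h O + σ.nextAt (σ.agentValue k) t h O =
      ∑ w, σ.buyProb t h O w * ∫⁻ m, max (ENNReal.ofReal (m : ℝ))
        (σ.agentValue k (t + 1) (Fin.snoc h (O, w, m))) ∂(signalLaw O w) := by
    rw [σ.consumeAt_add_nextAt]
    simp_rw [H.stop_add_cont_eq hk hk']
  have hbuy : ∀ w, τ.buyProb t h O w = if w = w' then 1 else 0 := by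
    intro w
    simp only [Profile.buyProb, hτ, Profile.withAgent, AgentStrategy.buyOnce, if_true,
      Kernel.const_apply, Measure.dirac_apply, Set.indicator_apply, Set.mem_singleton_iff,
      Pi.one_apply]
    simp only [eq_comm]
  have hs' : τ.consumeAt t h O + τ.nextAt (σ.agentValue k) t h O =
      ∫⁻ m, max (ENNReal.ofReal (m : ℝ)) (σ.agentValue k (t + 1) (Fin.snoc h (O, w', m)))
        ∂(signalLaw O w') := by
    rw [τ.consumeAt_add_nextAt]
    simp only [hbuy, ite_mul, one_mul, zero_mul, Finset.sum_ite_eq', Finset.mem_univ, if_true]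
    exact lintegral_congr fun m => H.stop_add_cont_eq hk hk' t h O w' m
  have ho' : τ.outlayAt k t h O = ENNReal.ofReal k + price O w' := by
    unfold Profile.outlayAt
    simp only [hbuy, ite_mul, one_mul, zero_mul, Finset.sum_ite_eq', Finset.mem_univ, if_true]
  rw [hs, hs', ho'] at h2
  unfold Profile.outlayAt at h2
  refine (ENNReal.add_le_add_iff_right (a := ENNReal.ofReal k + τ.nextAt (σ.outlay k) t h O +
    σ.nextAt (σ.outlay k) t h O) (ENNReal.add_ne_top.2 ⟨ENNReal.add_ne_top.2
      ⟨ENNReal.ofReal_ne_top, hfin τ⟩, hfin σ⟩)).1 ?_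
  refine le_trans (le_of_eq ?_) (h2.trans (le_of_eq ?_)) <;> ring

end IsEquilibrium

/-! ### The monopolist's guarantee -/

section Monopoly

variable {σ : Profile F 1} {k : ℝ}

open Classical in
/-- The monopolist can secure any price that makes her offer strictly better for the agent than
his best payoff without it. -/
theorem IsEquilibrium.le_brokerPayoff (H : IsEquilibrium k σ) (hk : 0 < k)
    (hk' : k < priorMean F) {M c : ℝ≥0∞} (hM : ∀ t h, σ.agentValue k t h ≤ M)
    (hmM : ENNReal.ofReal (priorMean F) ≤ M) (hc : ∀ t h, c ≤ σ.brokerPayoff 0 t h)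
    (p : ℝ≥0) (G : Signal F)
    (hpG : M + p < ENNReal.ofReal (expMax (G : ProbabilityMeasure Θ) (autarky F k)))
    (t : ℕ) (h : Hist F 1 t) :
    p + ∫⁻ m : Θ, (if (m : ℝ) < autarky F k then c else 0) ∂((G : ProbabilityMeasure Θ) : Measure Θ)
      ≤ σ.brokerPayoff 0 t h := by
  set O : Offers F 1 := fun _ => (p, G) with hO
  have hMtop : M ≠ ⊤ := fun h => by simp [h] at hpG
  have h1 := H.purchase_le hk hk' t h O (some 0)
  have hsum := σ.sum_buyProb t h O
  rw [Fintype.sum_option, Fin.sum_univ_one] at hsum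
  rw [Fintype.sum_option, Fin.sum_univ_one, Fintype.sum_option, Fin.sum_univ_one] at h1
  have hX0 : ∫⁻ m, max (ENNReal.ofReal (m : ℝ)) (σ.agentValue k (t + 1)
      (Fin.snoc h (O, none, m))) ∂(signalLaw O none) ≤ M := by
    simp only [signalLaw]
    rw [lintegral_dirac]
    exact max_le hmM (hM _ _)
  have hX1 : M + p < ∫⁻ m, max (ENNReal.ofReal (m : ℝ)) (σ.agentValue k (t + 1)
      (Fin.snoc h (O, some 0, m))) ∂(signalLaw O (some 0)) := by
    refine hpG.trans_le ?_
    rw [← lintegral_max_eq]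
    exact lintegral_mono fun m => max_le_max le_rfl (H.autarky_le_agentValue hk hk' _ _)
  have hX1top : ∫⁻ m, max (ENNReal.ofReal (m : ℝ)) (σ.agentValue k (t + 1)
      (Fin.snoc h (O, some 0, m))) ∂(signalLaw O (some 0)) ≠ ⊤ := by
    refine ne_top_of_le_ne_top ENNReal.one_ne_top ?_
    calc _ ≤ ∫⁻ _, 1 ∂(signalLaw O (some 0)) := lintegral_mono fun m =>
          max_le (ofReal_quality_le_one m) (tsub_le_self.trans (σ.quality_le_one _ _))
      _ = 1 := by simp
  have hb1top : σ.buyProb t h O (some 0) ≠ ⊤ :=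
    ne_top_of_le_ne_top ENNReal.one_ne_top (σ.buyProb_le_one t h O _)
  -- Refusal is worth at most `M`, acceptance strictly more than `M` net of the price. Sequential
  -- rationality at this off-path offer leaves refusal no probability, so ties play no role.
  have hbuy0 : σ.buyProb t h O none = 0 := by
    by_contra h0
    have hb0top : σ.buyProb t h O none ≠ ⊤ :=
      ne_top_of_le_ne_top ENNReal.one_ne_top (σ.buyProb_le_one t h O _)
    generalize ∫⁻ m, max (ENNReal.ofReal (m : ℝ)) (σ.agentValue k (t + 1)
      (Fin.snoc h (O, none, m))) ∂(signalLaw O none) = X0 at *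
    generalize ∫⁻ m, max (ENNReal.ofReal (m : ℝ)) (σ.agentValue k (t + 1)
      (Fin.snoc h (O, some 0, m))) ∂(signalLaw O (some 0)) = X1 at *
    simp only [price, hO, ENNReal.coe_zero, mul_zero, zero_add] at h1
    rw [← hO] at h1
    generalize σ.buyProb t h O none = b0 at *
    generalize σ.buyProb t h O (some 0) = b1 at *
    have h2 : b0 * X1 + (b1 * X1 + b1 * p) ≤ b0 * (X0 + p) + (b1 * X1 + b1 * p) := by
      calc _ = (b0 + b1) * X1 + b1 * p := by ring
        _ ≤ b0 * X0 + b1 * X1 + (b0 + b1) * p := by rw [hsum, one_mul, one_mul]; exact h1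
        _ = _ := by ring
    have h3 := (ENNReal.add_le_add_iff_right (ENNReal.add_ne_top.2
      ⟨ENNReal.mul_ne_top hb1top hX1top, ENNReal.mul_ne_top hb1top ENNReal.coe_ne_top⟩)).1 h2
    have h4 := (ENNReal.mul_le_mul_iff_right h0 hb0top).1 h3
    exact absurd (h4.trans (add_le_add_left hX0 _)) (not_le.2 hX1)
  rw [hbuy0, zero_add] at hsum
  have hdev := H.broker 0 t h ((σ.broker 0).offerOnce t (p, G))
  have hA := σ.agreesFrom_offerOnce 0 t (p, G)
  set τ := σ.withBroker 0 ((σ.broker 0).offerOnce t (p, G)) with hτ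
  refine le_trans ?_ hdev
  have hlaw : τ.offersLaw t h = Measure.dirac O := by
    unfold Profile.offersLaw
    rw [← pi_dirac]
    congr 1
    funext i
    obtain rfl := Subsingleton.elim i 0
    simp [hτ, Profile.withBroker, BrokerStrategy.offerOnce, hO]
  have hτbuy : ∀ w, τ.buyProb t h O w = σ.buyProb t h O w := fun _ => rfl
  have hτcont : ∀ w m, τ.contProb t h O w m = σ.contProb t h O w m := fun _ _ => rfl
  unfold Profile.brokerPayoff
  rw [Profile.total_eq _ (τ.measurable_revenue 0)]
  unfold Profile.revenue Profile.next Profile.nextAt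
  rw [hlaw, lintegral_dirac, lintegral_dirac, Fintype.sum_option, Fin.sum_univ_one]
  simp only [hτbuy, hτcont, hbuy0, hsum, zero_mul, zero_add, one_mul]
  -- Below `u̲` the agent surely continues, and the monopolist then gets at least `c`; her later
  -- income after other realizations is discarded.
  refine add_le_add le_rfl (lintegral_mono fun m => ?_)
  dsimp only
  split_ifs with hm
  · rw [H.contProb_eq_one hk hk' t h O (some 0) hm, one_mul]
    exact (hc _ _).trans (hA.brokerPayoff_eq 0 le_rfl _).ge
  · exact zero_le

/-- Above the threshold the monopolist extracts the whole surplus in every equilibrium. -/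
theorem IsEquilibrium.extraction (H : IsEquilibrium k σ) (hk : 0 < k) (hk' : k < priorMean F)
    (hφ : mcCall F k < expMax F (autarky F k)) (t : ℕ) (h : Hist F 1 t) :
    ENNReal.ofReal (mcCall F k - autarky F k) ≤ σ.brokerPayoff 0 t h := by
  classical
  have hle := autarky_le_mcCall hk hk'
  rcases hle.eq_or_lt with heq | hlt
  · simp [heq]
  have hau : 0 < autarky F k := by unfold autarky; linarith
  have hm0 := (priorMean_mem F).1
  obtain ⟨-, hu0, hu1⟩ := excess_mcCall hk hk'
  -- Extrema over all histories, on and off the path of play. The surplus bound at each history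
  -- gives `M + c ≤ u̅`.
  obtain ⟨c, hc⟩ : ∃ c, c = ⨅ (t : ℕ) (h : Hist F 1 t), σ.brokerPayoff 0 t h := ⟨_, rfl⟩
  obtain ⟨M, hMdef⟩ : ∃ M, M = ⨆ (t : ℕ) (h : Hist F 1 t), σ.agentValue k t h := ⟨_, rfl⟩
  have hcle : ∀ t h, c ≤ σ.brokerPayoff 0 t h := fun t h => hc ▸ iInf₂_le t h
  have hleM : ∀ t h, σ.agentValue k t h ≤ M := fun t h =>
    hMdef ▸ le_iSup₂ (f := fun t h => σ.agentValue k t h) t h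
  have hlec : ∀ x, (∀ t h, x ≤ σ.brokerPayoff 0 t h) → x ≤ c := fun x hx =>
    hc ▸ le_iInf₂ hx
  have hMle : ∀ x, (∀ t h, σ.agentValue k t h ≤ x) → M ≤ x := fun x hx =>
    hMdef ▸ iSup₂_le hx
  have hM1 : M ≤ 1 := hMle 1 fun t h => tsub_le_self.trans (σ.quality_le_one t h)
  have hsur : ∀ t h, σ.agentValue k t h + σ.brokerPayoff 0 t h ≤ ENNReal.ofReal (mcCall F k) := by
    intro t h
    have h1 := σ.surplus_le hk hk' t h
    rw [Fin.sum_univ_one, H.quality_eq hk hk'] at h1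
    refine (ENNReal.add_le_add_iff_left (H.outlay_ne_top hk hk' t h)).1 (le_trans (le_of_eq ?_) h1)
    ring
  have hcu : c ≤ ENNReal.ofReal (mcCall F k) := (hcle t h).trans (le_add_self.trans (hsur t h))
  lift c to ℝ≥0 using ne_top_of_le_ne_top ENNReal.ofReal_ne_top hcu
  lift M to ℝ≥0 using ne_top_of_le_ne_top ENNReal.one_ne_top hM1
  have hMc : (M : ℝ) ≤ mcCall F k - c := by
    have h1 : (M : ℝ≥0∞) ≤ ENNReal.ofReal (mcCall F k) - c := hMle _ fun t h =>
      ENNReal.le_sub_of_add_le_right ENNReal.coe_ne_top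
        ((add_le_add_right (hcle t h) _).trans (hsur t h))
    have h2 : (M : ℝ≥0∞) + c ≤ ENNReal.ofReal (mcCall F k) :=
      (add_le_add_left h1 _).trans (tsub_add_cancel_of_le hcu).le
    have h3 := ENNReal.toReal_mono ENNReal.ofReal_ne_top h2
    rw [ENNReal.toReal_add ENNReal.coe_ne_top ENNReal.coe_ne_top, ENNReal.coe_toReal,
      ENNReal.coe_toReal, ENNReal.toReal_ofReal hu0.le] at h3
    linarith
  have hprice : ∀ (x y z : ℝ), 0 ≤ x → 0 ≤ y → x + y < z →
      ENNReal.ofReal x + (y.toNNReal : ℝ≥0∞) < ENNReal.ofReal z := by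
    intro x y z hx hy hxy
    change ENNReal.ofReal x + ENNReal.ofReal y < _
    rw [← ENNReal.ofReal_add hx hy]
    exact (ENNReal.ofReal_lt_ofReal_iff (by linarith)).2 hxy
  have hcoe : ∀ x : ℝ≥0, (x : ℝ≥0∞) = ENNReal.ofReal (x : ℝ) := fun x => by simp
  have hMm : (M : ℝ≥0∞) ≤ ENNReal.ofReal (priorMean F) := by
    by_contra hcon
    rw [not_le] at hcon
    -- Half the gap `E max(θ, u̲) - u̅` is conceded, so that acceptance is strict while the price
    -- still exceeds `u̅ - M ≥ c`.
    set p : ℝ := expMax F (autarky F k) - M - (expMax F (autarky F k) - mcCall F k) / 2 with hp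
    have hc0 : 0 ≤ (c : ℝ) := c.2
    have hp0 : 0 ≤ p := by linarith
    have h1 := hlec p.toNNReal fun t h => le_trans le_self_add
      (H.le_brokerPayoff hk hk' hleM hcon.le hcle p.toNNReal ⟨F, isMPC_self F⟩
        (by rw [hcoe M]; exact hprice _ _ _ M.2 hp0 (by linarith)) t h)
    have h2 : p.toNNReal ≤ c := by exact_mod_cast h1
    have h3 := Real.toNNReal_le_iff_le_coe.1 h2
    linarith
  obtain ⟨s, a, b, hS⟩ := exists_extractionSignal hk hk'
  have hsD := mul_pos hS.pos (sub_pos.2 hlt)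
  have hint : ∫⁻ m : Θ, (if (m : ℝ) < autarky F k then (c : ℝ≥0∞) else 0)
      ∂(mixture s (pointMass a) (pointMass b) : Measure Θ) = ENNReal.ofReal ((1 - s) * c) := by
    rw [lintegral_mixture, lintegral_pointMass, lintegral_pointMass, if_pos (hS.low_lt hlt),
      if_neg (by linarith [hS.lt_high]), mul_zero, add_zero, hcoe c,
      ← ENNReal.ofReal_mul (by linarith [s.2.2])]
  -- With refusal worth at most `m`, the binary signal sells at any price below `s (u̅ - u̲)`. Hence
  -- `c ≥ s (u̅ - u̲) - ε + (1 - s) c`; let `ε → 0` and divide by `s`.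
  have hkey : ∀ ε, 0 < ε → s * (mcCall F k - autarky F k) ≤ s * c + ε := by
    intro ε hε
    rcases le_total (s * (mcCall F k - autarky F k)) ε with hbig | hsmall
    · have := mul_nonneg s.2.1 c.2
      change 0 ≤ (s : ℝ) * (c : ℝ) at this
      linarith
    set p : ℝ := s * (mcCall F k - autarky F k) - ε with hp
    have hp0 : 0 ≤ p := by linarith
    have h1 := hlec (ENNReal.ofReal p + ENNReal.ofReal ((1 - s) * c)) fun t h => by
      rw [← hint]
      exact H.le_brokerPayoff hk hk' (fun t h => (hleM t h).trans hMm) le_rfl hcle p.toNNReal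
        ⟨_, hS.isMPC⟩ (hprice _ _ _ hm0 hp0 (by rw [hS.expMax_eq hle]; linarith)) t h
    rw [hcoe c, ← ENNReal.ofReal_add hp0 (mul_nonneg (by linarith [s.2.2]) c.coe_nonneg),
      ENNReal.ofReal_le_ofReal_iff c.coe_nonneg] at h1
    linarith
  have h1 := le_of_forall_pos_le_add hkey
  have h2 := le_of_mul_le_mul_left h1 hS.pos
  refine le_trans ?_ (hcle t h)
  rw [hcoe c]
  exact ENNReal.ofReal_le_ofReal h2

theorem equilibriumPayoffs_eq_singleton (hk : 0 < k) (hk' : k < priorMean F)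
    (hφ : mcCall F k < expMax F (autarky F k)) :
    equilibriumPayoffs F 1 k = {![mcCall F k - autarky F k, autarky F k]} := by
  refine Set.Subset.antisymm (fun y hy => ?_) (Set.singleton_subset_iff.2 (extraction_mem hk hk'))
  obtain ⟨-, ha, hs⟩ := equilibriumPayoffs_subset hk hk' hy
  obtain ⟨σ, H, hB, -⟩ := hy
  have hD := H.extraction hk hk' hφ 0 Fin.elim0
  obtain ⟨hy0, hBy⟩ := coe_ennreal_eq_coe_real (hB 0)
  rw [hBy, ENNReal.ofReal_le_ofReal_iff hy0] at hD
  rw [Fin.sum_univ_two] at hs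
  change autarky F k ≤ y 1 at ha
  change mcCall F k - autarky F k ≤ y 0 at hD
  rw [Set.mem_singleton_iff]
  funext j
  fin_cases j
  · change y 0 = mcCall F k - autarky F k
    linarith
  · change y 1 = autarky F k
    linarith

end Monopoly

/-! ### The threshold of the monopolistic market -/

/-- The profile giving the monopolist `0` and the agent `u̲` is always feasible, so a singleton
leaves no surplus over autarky. This makes the two regimes of a threshold incompatible. -/
theorem mcCall_eq_autarky_of_singleton {k : ℝ} (hk : 0 < k) (hk' : k < priorMean F)
    (h : feasiblePayoffs F 1 k = {![mcCall F k - autarky F k, autarky F k]}) :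
    mcCall F k = autarky F k := by
  have hau : 0 < autarky F k := by unfold autarky; linarith
  have hle := autarky_le_mcCall hk hk'
  have hmem : (![0, autarky F k] : Fin 2 → ℝ) ∈ feasiblePayoffs F 1 k := by
    refine ⟨fun j => ?_, ?_, ?_⟩
    · fin_cases j
      · exact le_rfl
      · exact hau.le
    · exact le_rfl
    · rw [Fin.sum_univ_two]
      simpa using hle
  rw [h, Set.mem_singleton_iff] at hmem
  have := congrFun hmem 0
  simp only [Matrix.cons_val_zero] at this
  linarith

theorem exists_unique_threshold (hF : (F : Measure Θ) ≪ volume) :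
    ∃ κ : ℝ, 0 < κ ∧ κ < priorMean F ∧
      (∀ k, 0 < k → k ≤ κ → expMax F (autarky F k) ≤ mcCall F k) ∧
      IsMonopolyThreshold F κ ∧ ∀ κ', IsMonopolyThreshold F κ' → κ' = κ := by
  obtain ⟨κ, hκ0, hκm, hlow, hhigh⟩ := exists_threshold hF
  have hfolk : ∀ k, 0 < k → k ≤ κ → equilibriumPayoffs F 1 k = feasiblePayoffs F 1 k :=
    fun k hk hkκ => Set.Subset.antisymm (equilibriumPayoffs_subset hk (hkκ.trans_lt hκm))
      (feasiblePayoffs_subset hF one_pos hk (hkκ.trans_lt hκm) (hlow k hk hkκ))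
  have hext : ∀ k, κ < k → k < priorMean F →
      equilibriumPayoffs F 1 k = {![mcCall F k - autarky F k, autarky F k]} :=
    fun k hkκ hkm => equilibriumPayoffs_eq_singleton (hκ0.trans hkκ) hkm (hhigh k hkκ hkm)
  have hge : ∀ k, 0 < k → k ≤ κ → priorMean F ≤ mcCall F k := fun k hk hkκ =>
    ((le_max_left _ _).trans (max_priorMean_le F _)).trans (hlow k hk hkκ)
  refine ⟨κ, hκ0, hκm, hlow, ⟨hκ0, hκm, hfolk, hext⟩, fun κ' H => ?_⟩
  rcases lt_trichotomy κ' κ with hlt | heq | hgt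
  · exfalso
    -- At `κ` itself both regimes would hold, forcing `u̅ = u̲ < m`, whereas `u̅ ≥ m` below the
    -- threshold.
    have h1 := mcCall_eq_autarky_of_singleton hκ0 hκm
      ((hfolk κ hκ0 le_rfl).symm.trans (H.extraction κ hlt hκm))
    have h2 := hge κ hκ0 le_rfl
    rw [h1] at h2
    unfold autarky at h2
    linarith
  · exact heq
  · exfalso
    -- Both regimes hold on `(κ, κ']`, so `u̅ = u̲` there. By continuity `u̲` also solves the McCall
    -- equation at `κ`, where however `u̲ < m ≤ u̅`.
    have h1 : ∀ k ∈ Set.Ioc κ κ', excess F (autarky F k) - k = 0 := by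
      intro k hk
      have hk0 := hκ0.trans hk.1
      have hkm := hk.2.trans_lt H.lt_priorMean
      have h2 := mcCall_eq_autarky_of_singleton hk0 hkm
        ((H.folk k hk0 hk.2).symm.trans (hext k hk.1 hkm))
      rw [← h2, (excess_mcCall hk0 hkm).1, sub_self]
    have hcont : Continuous fun k => excess F (autarky F k) - k := by
      have : Continuous (autarky F) := by unfold autarky; fun_prop
      exact ((continuous_excess F).comp this).sub continuous_id
    have h3 : excess F (autarky F κ) - κ = 0 := by
      have hcl : κ ∈ closure (Set.Ioc κ κ') := by
        rw [closure_Ioc hgt.ne]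
        exact Set.left_mem_Icc.2 hgt.le
      exact (isClosed_eq hcont continuous_const).closure_subset_iff.2 h1 hcl
    have h4 := excess_lt (F := F) (u := autarky F κ) (v := mcCall F κ)
      (by have := hge κ hκ0 le_rfl; unfold autarky; linarith) (by linarith)
    rw [(excess_mcCall hκ0 hκm).1] at h4
    linarith

end PersuadedSearch

end

theorem proposition3 (F : MeasureTheory.ProbabilityMeasure unitInterval)
    (hF : (F : MeasureTheory.Measure unitInterval) ≪ MeasureTheory.volume) :
    (∃! kstar : ℝ, PersuadedSearch.IsMonopolyThreshold F kstar) ∧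
      ∀ kstar : ℝ, PersuadedSearch.IsMonopolyThreshold F kstar →
        ∀ k : ℝ, 0 < k → k ≤ kstar → ∀ n : ℕ, 1 < n →
          PersuadedSearch.equilibriumPayoffs F n k = PersuadedSearch.feasiblePayoffs F n k := by
  obtain ⟨κ, -, hκm, hlow, hκ, huniq⟩ := PersuadedSearch.exists_unique_threshold hF
  refine ⟨⟨κ, hκ, huniq⟩, fun κ' hκ' k hk hkκ n hn => ?_⟩
  -- Uniqueness turns an arbitrary monopoly threshold into the cutoff at which `E max(θ, u̲) ≤ u̅`
  -- is known, the only property the folk construction needs.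
  obtain rfl := huniq κ' hκ'
  exact Set.Subset.antisymm (PersuadedSearch.equilibriumPayoffs_subset hk (hkκ.trans_lt hκm))
    (PersuadedSearch.feasiblePayoffs_subset hF (by omega) hk (hkκ.trans_lt hκm) (hlow k hk hkκ))
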